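/- **Setting.** Let $\sigma_i$ be the Pauli matrices, $\tau_i=-\tfrac i2\sigma_i$, and let $X\triangleright n$ be the adjoint action of $X\in SU(2)$ on $\mathbb R^3\cong\mathfrak{su}(2)$, $n\leftrightarrow n^i\tau_i$. Identify $\mathfrak{su}(2)\oplus\mathfrak{su}(2)$ with $\mathfrak{so}(4)$ by $(J_-,J_+)\leftrightarrow J^{IJ}$, $J^{ij}=\epsilon^{ij}{}_k(J_+^k+J_-^k)$, $J^{0i}=J_+^i-J_-^i$. The group $Spin(4)=SU(2)\times SU(2)\ni G=(X^-,X^+)$ acts on $\mathbb R^4$ by $\zeta(G\cdot V)=X^-\zeta(V)(X^+)^{-1}$, where $\zeta(V)=V^0I+i\sigma_iV^i$. Put $\mathcal N=(1,0,0,0)$, and for $G_a=(X_a^-,X_a^+)$, $a=0,\dots,4$, put $G_{ab}=G_a^{-1}G_b=(X^-_{ab},X^+_{ab})$. *Reduced boundary data* $\{A_{ab},n_{ab}\}$ consist of areas $A_{ab}=A_{ba}>0$ and unit vectors $n_{ab}\in\mathbb R^3$ for all $a\ne b$ in $\{0,\dots,4\}$. They are *nondegenerate* if for each $a$ the vectors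 $n_{ab}$, $b\neq a$, span $\mathbb R^3$, and satisfy *closure* if $\sum_{b\ne a}A_{ab}n_{ab}=0$ for each $a$. The *orientation constraint* on $\{G_a\}$ is $X_a^\pm\triangleright n_{ab}=-X_b^\pm\triangleright n_{ba}$ for all $a\neq b$. For constants $\kappa,\gamma>0$ let $L_{ab}=\frac1{\kappa\gamma}A_{ab}n_{ab}$. The *physical bivectors* are $$B^{\rm phys}_{ab}=\tfrac12A_{ab}\left(-X_a^-\triangleright n_{ab},\;X_a^+\triangleright n_{ab}\right).$$ With $\{c,d,e\}=\{0,\dots,4\}\setminus\{a,b\}$ in any order and $\mathrm{sgn}\,0=0$, let $$\beta_{ab}=-\mathrm{sgn}\left[\epsilon_{ijk}(G_{ac}\cdot\mathcal N)^i(G_{ad}\cdot\mathcal N)^j(G_{ae}\cdot\mathcal N)^k\;\epsilon_{lmn}(G_{bc}\cdot\mathcal N)^l(G_{bd}\cdot\mathcal N)^m(G_{be}\cdot\mathcal N)^n\right].$$ Let $S\subset\mathbb R^4$ be the 4-simplex with affinely independent vertices $p_0,\dots,p_4$, with the standard orientation of $\mathbb R^4$; tetrahedron $a$ is the face opposite to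 $p_a$, and $\Delta_{ab}$ is the triangle common to tetrahedra $a$ and $b$, oriented as part of the boundary of tetrahedron $a$, which is oriented as part of $\partial S$. For a constant $\mathfrak{so}(4)$-valued two-form $B^{IJ}_{\mu\nu}$ put $\omega(B)=\mathrm{sgn}\left(\epsilon^{\mu\nu\rho\sigma}\epsilon_{IJKL}B^{IJ}_{\mu\nu}B^{KL}_{\rho\sigma}\right)$. Put $\nu(B)=0$ if this argument of $\mathrm{sgn}$ vanishes, and otherwise $\nu(B)=\pm1$ if $B^{IJ}=\pm\frac12\epsilon^{IJ}{}_{KL}e^K\wedge e^L$ for some $e^I_\mu$ (sector (II$\pm$)), and $\nu(B)=0$ if there is no such $e$ for either sign. Bivectors $\{\mathcal B_{ab}\}$ are in the *Einstein–Hilbert sector* if there is a constant two-form $B$ with $\int_{\Delta_{ab}}B=\mathcal B_{ab}$ for all $a\neq b$ and $\nu(B)\,\omega(B)=+1$. For a geometrical 4-simplex $\sigma\subset\mathbb R^4$ with numbered tetrahedra and outward unit normals $N_a$, let $B^{\rm geom}_{ab}(\sigma)=A(\Delta_{ab}(\sigma))\,\frac{N_a\wedge N_b}{|N_a\wedge N_b|}$,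 where $A(\Delta_{ab}(\sigma))$ is the area of the triangle common to tetrahedra $a$ and $b$, $(N_a\wedge N_b)^{IJ}=N_a^IN_b^J-N_a^JN_b^I$ and $|X|^2=\frac12X^{IJ}X_{IJ}$. **Theorem.** Let $\{A_{ab},n_{ab}\}$ be nondegenerate reduced boundary data satisfying closure, and let $\{G_a\}\subset Spin(4)$, $a=0,\dots,4$, solve the orientation constraint. Let $S$ be any 4-simplex as above. Then: 1. there is exactly one constant two-form $B$ on $S$ with $\int_{\Delta_{ab}}B=B^{\rm phys}_{ab}$ for all $a\ne b$; 2. $\{B^{\rm phys}_{ab}\}$ is in the Einstein–Hilbert sector ($\nu\omega=+1$) if and only if $B^{\rm phys}_{ab}=\mu B^{\rm geom}_{ab}(\sigma)$ for all $a\ne b$ holds with $\mu=+1$ for some numbered 4-simplex $\sigma$; 3. for any one pair $a\neq b$, $\{B^{\rm phys}_{ab}\}$ is in the Einstein–Hilbert sector if and only if $$\beta_{ab}(\{G_{a'b'}\})\;\mathrm{tr}\left(\tau_iX^-_{ab}X^+_{ba}\right)L^i_{ab}>0.$$ -/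

import Mathlib

open scoped BigOperators

namespace EPRL

noncomputable section

/-! Indices: `Fin 4` labels `ℝ⁴` with `0` the internal time direction; a spatial index `i : Fin 3`
is the index `i.succ : Fin 4`. Tetrahedra of a 4-simplex are labelled by `a : Fin 5`, tetrahedron
`a` being the one opposite to vertex `a`. -/

abbrev R3 := EuclideanSpace ℝ (Fin 3)

abbrev R4 := EuclideanSpace ℝ (Fin 4)

/-- Bivectors `J^{IJ}`; all those that occur below are antisymmetric. -/
abbrev Bivector := Matrix (Fin 4) (Fin 4) ℝ

abbrev SU2 := Matrix.specialUnitaryGroup (Fin 2) ℂ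

/-- `Spin(4) = SU(2) × SU(2)`, with elements `G = (X⁻, X⁺)`. -/
abbrev Spin4 := SU2 × SU2

/-! ### `SU(2)`, `Spin(4)` and their actions -/

/-- The Pauli matrices. -/
def pauli : Fin 3 → Matrix (Fin 2) (Fin 2) ℂ :=
  ![!![0, 1; 1, 0], !![0, -Complex.I; Complex.I, 0], !![1, 0; 0, -1]]

/-- `τ_i = -(i/2) σ_i`, a basis of `su(2)`. -/
def tau (i : Fin 3) : Matrix (Fin 2) (Fin 2) ℂ := (-Complex.I / 2) • pauli i

/-- The element `v^i τ_i` of `su(2)`. -/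
def su2 (v : R3) : Matrix (Fin 2) (Fin 2) ℂ := ∑ i, (v i : ℂ) • tau i

/-- The adjoint action `X ▷ v` in components with respect to `τ_i`
(the component of `M ∈ su(2)` along `τ_i` is `-2 tr(τ_i M)`; see `su2_adj`). -/
def adj (X : SU2) (v : R3) : R3 :=
  WithLp.toLp 2 fun i =>
    -2 * (Matrix.trace (tau i * (X.1 * su2 v * (X⁻¹).1))).re

/-- `ζ(V) = V⁰ I + i σ_i V^i`. -/
def zeta (V : R4) : Matrix (Fin 2) (Fin 2) ℂ :=
  (V 0 : ℂ) • (1 : Matrix (Fin 2) (Fin 2) ℂ) + ∑ i : Fin 3, (Complex.I * (V i.succ : ℂ)) • pauli i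

/-- The action of `Spin(4)` on `ℝ⁴`, characterized by `ζ(G · V) = X⁻ ζ(V) (X⁺)⁻¹`
(see `zeta_act`). -/
def act (G : Spin4) (V : R4) : R4 :=
  WithLp.toLp 2 (Fin.cons
    ((Matrix.trace (G.1.1 * zeta V * (G.2⁻¹).1)).re / 2)
    fun i => (Matrix.trace (tau i * (G.1.1 * zeta V * (G.2⁻¹).1))).re)

/-- The reference vector `𝒩 = (1,0,0,0)`. -/
def refNormal : R4 := EuclideanSpace.single 0 1

/-- The isomorphism `su(2) ⊕ su(2) ≅ so(4)`, `(J₋, J₊) ↦ J^{IJ}` with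
`J^{ij} = ε^{ij}_k (J₊ + J₋)^k` and `J^{0i} = J₊^i - J₋^i`. -/
def toBivector (Jm Jp : R3) : Bivector :=
  let d := Jp - Jm
  let s := Jp + Jm
  !![0,      d 0,    d 1,    d 2;
     -(d 0), 0,      s 2,    -(s 1);
     -(d 1), -(s 2), 0,      s 0;
     -(d 2), s 1,    -(s 0), 0]

/-- `G_{ab} = G_a⁻¹ G_b`. -/
def rel (G : Fin 5 → Spin4) (a b : Fin 5) : Spin4 := (G a)⁻¹ * G b

/-! ### Reduced boundary data -/

/-- One unit vector `n_{ab}` per ordered pair `a ≠ b`, and one area `A_{ab} = A_{ba} > 0` per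
triangle. Values on the diagonal play no role. -/
structure ReducedBoundaryData where
  area : Fin 5 → Fin 5 → ℝ
  normal : Fin 5 → Fin 5 → R3
  area_symm : ∀ a b, a ≠ b → area a b = area b a
  area_pos : ∀ a b, a ≠ b → 0 < area a b
  normal_unit : ∀ a b, a ≠ b → ‖normal a b‖ = 1

namespace ReducedBoundaryData

variable (D : ReducedBoundaryData)

/-- For each `a`, the vectors `n_{ab}`, `b ≠ a`, span a three dimensional space. -/
def Nondegenerate : Prop :=
  ∀ a, Module.finrank ℝ (Submodule.span ℝ (D.normal a '' {b | b ≠ a})) = 3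

/-- `∑_{b ≠ a} A_{ab} n_{ab} = 0`. -/
def Closure : Prop :=
  ∀ a, ∑ b ∈ Finset.univ.erase a, D.area a b • D.normal a b = 0

/-- The orientation constraint `X^±_a ▷ n_{ab} = - X^±_b ▷ n_{ba}`. -/
def Orientation (G : Fin 5 → Spin4) : Prop :=
  ∀ a b, a ≠ b →
    adj (G a).1 (D.normal a b) = -adj (G b).1 (D.normal b a) ∧
    adj (G a).2 (D.normal a b) = -adj (G b).2 (D.normal b a)

/-- The physical bivectors `½ A_{ab} (-X⁻_a ▷ n_{ab}, X⁺_a ▷ n_{ab})`. -/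
def physBivector (G : Fin 5 → Spin4) (a b : Fin 5) : Bivector :=
  (D.area a b / 2) •
    toBivector (-adj (G a).1 (D.normal a b)) (adj (G a).2 (D.normal a b))

/-- The rotation generators `L_{ab} = J⁻_{ab} + J⁺_{ab} = A_{ab} n_{ab} / (κ γ)`. -/
def rotGen (κ γ : ℝ) (a b : Fin 5) : R3 := (D.area a b / (κ * γ)) • D.normal a b

end ReducedBoundaryData

/-! ### The sign `β_{ab}` -/

/-- `ε_{ijk} (G_{ac}·𝒩)^i (G_{ad}·𝒩)^j (G_{ae}·𝒩)^k`. -/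
def spatialTriple (G : Fin 5 → Spin4) (a c d e : Fin 5) : ℝ :=
  Matrix.det (Matrix.of
    ![fun i : Fin 3 => act (rel G a c) refNormal i.succ,
      fun i : Fin 3 => act (rel G a d) refNormal i.succ,
      fun i : Fin 3 => act (rel G a e) refNormal i.succ])

/-- The three indices different from `a` and `b` (for `a ≠ b`), in increasing order. -/
def others (a b : Fin 5) (i : Fin 3) : Fin 5 :=
  ((List.finRange 5).filter fun c => c ≠ a ∧ c ≠ b).getD i 0

/-- `β_{ab}({G})`, with `Real.sign 0 = 0`. The order in which `c, d, e` are taken is irrelevant,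
see `beta_eq`. -/
def beta (G : Fin 5 → Spin4) (a b : Fin 5) : ℝ :=
  -Real.sign
    (spatialTriple G a (others a b 0) (others a b 1) (others a b 2) *
     spatialTriple G b (others a b 0) (others a b 1) (others a b 2))

/-! ### Two-forms on the 4-simplex, Plebanski sectors and orientation

A flat connection adapted to the oriented 4-simplex `S` amounts to an affine chart in which `S` is
the convex hull of five affinely independent points `p 0, …, p 4` of `ℝ⁴`, `ℝ⁴` having its standard
orientation. A form that is constant for the connection has constant components in this chart. -/

/-- A bivector-valued two-form at a point of `ℝ⁴`: `B ![u, v] I J = B_{μν}^{IJ} u^μ v^ν`. -/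
abbrev TwoForm := R4 [⋀^Fin 2]→ₗ[ℝ] Bivector

/-- The Levi-Civita symbol with `ε_{0123} = 1`. -/
def eps (I J K L : Fin 4) : ℝ :=
  ((((J : ℤ) - I) * ((K : ℤ) - I) * ((L : ℤ) - I) * ((K : ℤ) - J) * ((L : ℤ) - J) *
    ((L : ℤ) - K)).sign : ℝ)

/-- `(u ∧ v)^{IJ} = u^I v^J - u^J v^I`. -/
def wedge (u v : R4) : Bivector := Matrix.of fun I J => u I * v J - u J * v I

/-- The Hodge dual `½ ε^{IJ}_{KL} F^{KL}`. -/
def hodge (F : Bivector) : Bivector :=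
  Matrix.of fun I J => (1 / 2) * ∑ K, ∑ L, eps I J K L * F K L

/-- The integral of a two-form field over the triangle with vertices `x, y, z`, oriented by
`(y - x, z - x)`. -/
def triangleIntegral (B : R4 → TwoForm) (x y z : R4) : Bivector :=
  Matrix.of fun I J => ∫ s in (0 : ℝ)..1, ∫ t in (0 : ℝ)..(1 - s),
    B (x + s • (y - x) + t • (z - x)) ![y - x, z - x] I J

/-- For `{c, d, e}` the complement of `{a, b}`: the order `(c, d, e)` of the vertices of `Δ_{ab}`
is positive for the orientation of `Δ_{ab}` as part of the boundary of tetrahedron `a`, which is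
itself oriented as part of the boundary of `S` (outward vector first, both times: `p c - p a`
points out of `S` through tetrahedron `a`, and `p c - p b` points out of tetrahedron `a` through
`Δ_{ab}`). -/
def PositiveOrder (p : Fin 5 → R4) (a b c d e : Fin 5) : Prop :=
  0 < Matrix.det (Matrix.of
    ![⇑(p c - p a), ⇑(p c - p b), ⇑(p d - p c), ⇑(p e - p c)])

/-- `B` is the (constant, `so(4)`-valued) continuum two-form reconstructed from the bivectors
`𝓑_{ab}`: its integral over each `Δ_{ab}` is `𝓑_{ab}`. -/
def IsContinuumForm (p : Fin 5 → R4) (𝓑 : Fin 5 → Fin 5 → Bivector) (B : TwoForm) : Prop :=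
  (∀ u v : R4, (B ![u, v]).transpose = -B ![u, v]) ∧
  ∀ a b c d e : Fin 5, [a, b, c, d, e].Nodup → PositiveOrder p a b c d e →
    triangleIntegral (fun _ => B) (p c) (p d) (p e) = 𝓑 a b

/-- The component `B_{μν}^{IJ}`. -/
def TwoForm.comp (B : TwoForm) (μ ν I J : Fin 4) : ℝ :=
  B ![EuclideanSpace.single μ 1, EuclideanSpace.single ν 1] I J

/-- `ε^{μνρσ} ε_{IJKL} B_{μν}^{IJ} B_{ρσ}^{KL}`, whose vanishing is the degenerate sector. -/
def TwoForm.scalar (B : TwoForm) : ℝ :=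
  ∑ μ, ∑ ν, ∑ ρ, ∑ σ, ∑ I, ∑ J, ∑ K, ∑ L,
    eps μ ν ρ σ * eps I J K L * B.comp μ ν I J * B.comp ρ σ K L

/-- `ω(B)`, the dynamical orientation relative to the fixed one. -/
def TwoForm.orientation (B : TwoForm) : ℝ := Real.sign B.scalar

/-- `B^{IJ} = s · ½ ε^{IJ}_{KL} e^K ∧ e^L` for some co-tetrad `e`: sector (II+) for `s = 1`,
sector (II-) for `s = -1`. -/
def TwoForm.InSectorII (B : TwoForm) (s : ℝ) : Prop :=
  ∃ e : R4 →ₗ[ℝ] R4, ∀ u v : R4, B ![u, v] = s • hodge (wedge (e u) (e v))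

open Classical in
/-- `ν(B)`: `0` if `B` is degenerate, `1` in sector (II+), `-1` in sector (II-). -/
def TwoForm.sector (B : TwoForm) : ℝ :=
  if B.scalar = 0 then 0
  else if B.InSectorII 1 then 1
  else if B.InSectorII (-1) then -1
  else 0

/-- The bivectors `𝓑_{ab}` are in the Einstein–Hilbert sector: `ν ω = +1` for the reconstructed
two-form, i.e. (II+) with positive or (II-) with negative orientation. -/
def InEinsteinHilbertSector (p : Fin 5 → R4) (𝓑 : Fin 5 → Fin 5 → Bivector) : Prop :=
  ∃ B : TwoForm, IsContinuumForm p 𝓑 B ∧ B.sector * B.orientation = 1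

/-! ### Geometrical bivectors -/

/-- `|X| = (½ X^{IJ} X_{IJ})^{1/2}`. -/
def bivNorm (X : Bivector) : ℝ := Real.sqrt ((1 / 2) * ∑ I, ∑ J, X I J ^ 2)

/-- `N` is the outward unit normal to tetrahedron `a` of the 4-simplex with vertices `q`. -/
def IsOutwardNormal (q : Fin 5 → R4) (a : Fin 5) (N : R4) : Prop :=
  ‖N‖ = 1 ∧ (∀ c d, c ≠ a → d ≠ a → inner ℝ N (q c - q d) = 0) ∧
    ∀ c, c ≠ a → inner ℝ N (q a - q c) < 0

/-- The area of the triangle `Δ_{ab}`. -/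
def triangleArea (q : Fin 5 → R4) (a b : Fin 5) : ℝ :=
  bivNorm (wedge (q (others a b 1) - q (others a b 0)) (q (others a b 2) - q (others a b 0))) / 2

/-- `A(Δ_{ab}) (N_a ∧ N_b) / |N_a ∧ N_b|`, for outward unit normals `N`. -/
def geomBivector (q : Fin 5 → R4) (N : Fin 5 → R4) (a b : Fin 5) : Bivector :=
  (triangleArea q a b / bivNorm (wedge (N a) (N b))) • wedge (N a) (N b)

/-- There is a numbered geometrical 4-simplex `σ` with `𝓑_{ab} = μ B^{geom}_{ab}(σ)`. -/
def HasReconstructionSign (𝓑 : Fin 5 → Fin 5 → Bivector) (μ : ℝ) : Prop :=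
  ∃ q N : Fin 5 → R4, AffineIndependent ℝ q ∧ (∀ a, IsOutwardNormal q a (N a)) ∧
    ∀ a b, a ≠ b → 𝓑 a b = μ • geomBivector q N a b

/-! ### Facts showing that the definitions are as intended -/

theorem quat_form (X : SU2) : ∃ α β : ℂ,
    X.1 = !![α, -(starRingEnd ℂ) β; β, (starRingEnd ℂ) α] := by
  obtain ⟨M, hM⟩ := X
  obtain ⟨hu, hd⟩ := Matrix.mem_specialUnitaryGroup_iff.1 hM
  have h1 := Matrix.mem_unitaryGroup_iff'.1 hu
  have hadj : star M = M.adjugate := by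
    have h2 : M * M.adjugate = 1 := by rw [Matrix.mul_adjugate, hd, one_smul]
    calc star M = star M * (M * M.adjugate) := by rw [h2, mul_one]
      _ = M.adjugate := by rw [← mul_assoc, h1, one_mul]
  rw [Matrix.adjugate_fin_two] at hadj
  have e0 := congrFun (congrFun hadj 0) 0
  have e1 := congrFun (congrFun hadj 1) 0
  simp [Matrix.star_apply] at e0 e1
  have e1' : M 0 1 = -(starRingEnd ℂ) (M 1 0) := by
    rw [← Complex.conj_conj (M 0 1), e1, map_neg]
  refine ⟨M 0 0, M 1 0, ?_⟩
  ext i j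
  fin_cases i <;> fin_cases j <;> simp [e0, e1']

theorem inv_form (X : SU2) : (X⁻¹).1 = star X.1 := rfl

theorem star_form (a b c d : ℂ) : star !![a, b; c, d] =
    !![(starRingEnd ℂ) a, (starRingEnd ℂ) c; (starRingEnd ℂ) b, (starRingEnd ℂ) d] := by
  ext i j
  fin_cases i <;> fin_cases j <;> simp [Matrix.star_apply]

theorem zeta_form (V : R4) : zeta V =
    !![(V 0 : ℂ) + Complex.I * V 3, Complex.I * V 1 + V 2;
       Complex.I * V 1 - V 2, (V 0 : ℂ) - Complex.I * V 3] := by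
  have h2 : (Fin.succ 2 : Fin 4) = 3 := rfl
  ext i j
  fin_cases i <;> fin_cases j <;>
    simp [zeta, Fin.sum_univ_three, pauli, Complex.ext_iff, h2]

theorem su2_form (v : R3) : su2 v = (-Complex.I / 2) •
    !![(v 2 : ℂ), v 0 - Complex.I * v 1; v 0 + Complex.I * v 1, -(v 2 : ℂ)] := by
  ext i j
  fin_cases i <;> fin_cases j <;>
    simp [su2, Fin.sum_univ_three, tau, pauli, Complex.ext_iff] <;>
    first | ring1 | (constructor <;> ring1)

theorem su2_adj (X : SU2) (v : R3) : su2 (adj X v) = X.1 * su2 v * (X⁻¹).1 := by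
  obtain ⟨α, β, hX⟩ := quat_form X
  rw [su2_form, adj, inv_form, hX, star_form, su2_form]
  ext i j
  fin_cases i <;> fin_cases j <;>
    simp [tau, pauli, Matrix.trace_fin_two, Matrix.mul_apply,
      Fin.sum_univ_two, Complex.ext_iff] <;> constructor <;> ring

theorem zeta_act (G : Spin4) (V : R4) :
    zeta (act G V) = G.1.1 * zeta V * (G.2⁻¹).1 := by
  obtain ⟨α, β, hX⟩ := quat_form G.1
  obtain ⟨α', β', hX'⟩ := quat_form G.2
  have h1 : (1 : Fin 4) = Fin.succ 0 := rfl
  have h2 : (2 : Fin 4) = Fin.succ 1 := rfl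
  have h3 : (3 : Fin 4) = Fin.succ 2 := rfl
  have e0 (M) (x : ℝ) (f : Fin 3 → ℝ) (hM : zeta V = M) :
      zeta (WithLp.toLp 2 (Fin.cons x f : Fin 4 → ℝ)) =
      !![(x : ℂ) + Complex.I * f 2, Complex.I * f 0 + f 1;
       Complex.I * f 0 - f 1, (x : ℂ) - Complex.I * f 2] := by
    rw [zeta_form, h1, h2, h3]; rfl
  rw [act, e0 _ _ _ rfl, inv_form, hX, hX', star_form, zeta_form]
  ext i j
  fin_cases i <;> fin_cases j <;>
    simp [tau, pauli, Matrix.trace_fin_two, Matrix.mul_apply,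
      Fin.sum_univ_two, Complex.ext_iff] <;> constructor <;> ring

/-- `(G_{ab}·𝒩)^i = tr(τ_i X⁻_{ab} X⁺_{ba})`; in particular this trace is real. -/
theorem act_rel_refNormal (G : Fin 5 → Spin4) (a b : Fin 5) (i : Fin 3) :
    (act (rel G a b) refNormal i.succ : ℂ) =
      Matrix.trace (tau i * ((rel G a b).1.1 * (rel G b a).2.1)) := by
  have h : (rel G b a).2 = (rel G a b).2⁻¹ := by simp [rel]
  have hz : zeta refNormal = 1 := by
    ext i j; fin_cases i <;> fin_cases j <;> simp [zeta_form, refNormal]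
  have := zeta_act (rel G a b) refNormal
  rw [hz, mul_one] at this
  rw [h, ← this, zeta_form]
  fin_cases i <;>
    simp [tau, pauli, Matrix.trace_fin_two, Complex.ext_iff] <;> ring

theorem spatialTriple_swap (G : Fin 5 → Spin4) (a c d e : Fin 5) :
    spatialTriple G a d c e = -spatialTriple G a c d e ∧
    spatialTriple G a c e d = -spatialTriple G a c d e := by
  simp only [spatialTriple, Matrix.det_fin_three]
  constructor <;> simp <;> ring

theorem others_cases : ∀ a b c d e : Fin 5, [a, b, c, d, e].Nodup →
    (others a b 0 = c ∧ others a b 1 = d ∧ others a b 2 = e) ∨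
    (others a b 0 = c ∧ others a b 1 = e ∧ others a b 2 = d) ∨
    (others a b 0 = d ∧ others a b 1 = c ∧ others a b 2 = e) ∨
    (others a b 0 = d ∧ others a b 1 = e ∧ others a b 2 = c) ∨
    (others a b 0 = e ∧ others a b 1 = c ∧ others a b 2 = d) ∨
    (others a b 0 = e ∧ others a b 1 = d ∧ others a b 2 = c) := by
  set_option maxRecDepth 100000 in decide

theorem beta_eq (G : Fin 5 → Spin4) (a b c d e : Fin 5) (h : [a, b, c, d, e].Nodup) :
    beta G a b = -Real.sign (spatialTriple G a c d e * spatialTriple G b c d e) := by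
  have s1 (x) := (spatialTriple_swap G x c d e).1
  have s2 (x) := (spatialTriple_swap G x c d e).2
  have s3 (x) : spatialTriple G x d e c = spatialTriple G x c d e := by
    rw [(spatialTriple_swap G x d c e).2, s1, neg_neg]
  have s4 (x) : spatialTriple G x e c d = spatialTriple G x c d e := by
    rw [(spatialTriple_swap G x c e d).1, s2, neg_neg]
  have s5 (x) : spatialTriple G x e d c = -spatialTriple G x c d e := by
    rw [(spatialTriple_swap G x e c d).2, s4]
  rcases others_cases a b c d e h with h | h | h | h | h | h <;>
    obtain ⟨h0, h1, h2⟩ := h <;>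
    simp only [beta, h0, h1, h2, s1, s2, s3, s4, s5, neg_mul_neg]

theorem triangleIntegral_const (B : TwoForm) (x y z : R4) :
    triangleIntegral (fun _ => B) x y z = (1 / 2 : ℝ) • B ![y - x, z - x] := by
  ext I J
  simp only [triangleIntegral, intervalIntegral.integral_const, Matrix.of_apply, sub_zero,
    smul_eq_mul, intervalIntegral.integral_mul_const, Matrix.smul_apply]
  congr 1
  rw [intervalIntegral.integral_sub (by simp) (by simp)]
  norm_num

end

end EPRL

open EPRL

/-!
The bivectors `(vol q / 2) • g_a ∧ g_b`, with `g_a` the gradients of the barycentric coordinates of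
a 4-simplex `q` (`IsDual`), are at the same time its geometrical bivectors
(`IsDual.geomBivector_eq`) and the integrals of `± ⋆(e ∧ e)` over the triangles of the chart simplex
`p`, where `e` is the linear map underlying the affine map from `p` to `q` and the sign is that of
`det e` (`value_of_isDual`). The reason for both is that the Hodge dual of the triangle `Δ_{ab}` is
a multiple of `g_a ∧ g_b`.

*Existence and uniqueness of the two-form.* A constant two-form is determined by its values on
pairs of edges at one vertex. Conversely, bivectors antisymmetric in `a, b` and satisfying closure
come from an explicit form, a sum of `det(p_a, p_b, u, v) 𝓑_{ab}`, see `exists_isContinuumForm`.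

*The Einstein–Hilbert sector.* The scalar of the form `s ⋆(e ∧ e)`, `s = ±1`, is `96 det e`, and
the sectors (II+) and (II-) are disjoint on nondegenerate forms. Hence `ν ω = 1` means that the
form is `s ⋆(e ∧ e)` with `s` the sign of `det e`, which is to say that the bivectors are those of
the image of `p` under `e`. This holds for arbitrary bivectors (`inEinsteinHilbertSector_iff`).

*The sign condition.* Put `N_a = G_a·𝒩` and `v_{ab} = G_a·(0, n_{ab})`. The physical bivector is
`A_{ab} N_a ∧ v_{ab}`. As it equals `-A_{ab} N_b ∧ v_{ba}`, the vector `N_b` lies in the plane of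
`N_a` and `v_{ab}`. The sum over `i` in the condition is a positive multiple of `⟨v_{ab}, N_b⟩`, and
`β_{ab}` is the sign of `-det(N_a, N_c, N_d, N_e) det(N_b, N_c, N_d, N_e)`. If the product is
positive, the normals span `ℝ⁴` and satisfy, up to scale, one linear relation `∑ k_a N_a = 0`.
Closure forces the bivectors to be `λ k_a N_a ∧ k_b N_b`, and the sign condition says `λ > 0`; the
`k_a N_a`, suitably scaled, are then the gradients for a simplex with the given bivectors
(`NormalConfiguration.exists_isDual_of_pos`). For the bivectors of a geometrical simplex the `N_a`
are multiples of the gradients, and the same computation of signs gives the converse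
(`NormalConfiguration.pos_of_isDual`).
-/

namespace EPRL

/-! ### Determinants and bivectors -/

/-- The determinant of four vectors of `ℝ⁴`, the rows of the matrix. -/
noncomputable def det4 (u v w x : R4) : ℝ :=
  Matrix.det (Matrix.of ![⇑u, ⇑v, ⇑w, ⇑x])

theorem det4_eq (u v w x : R4) : det4 u v w x =
    u 0 * (v 1 * (w 2 * x 3 - w 3 * x 2) - v 2 * (w 1 * x 3 - w 3 * x 1)
      + v 3 * (w 1 * x 2 - w 2 * x 1))
    - u 1 * (v 0 * (w 2 * x 3 - w 3 * x 2) - v 2 * (w 0 * x 3 - w 3 * x 0)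
      + v 3 * (w 0 * x 2 - w 2 * x 0))
    + u 2 * (v 0 * (w 1 * x 3 - w 3 * x 1) - v 1 * (w 0 * x 3 - w 3 * x 0)
      + v 3 * (w 0 * x 1 - w 1 * x 0))
    - u 3 * (v 0 * (w 1 * x 2 - w 2 * x 1) - v 1 * (w 0 * x 2 - w 2 * x 0)
      + v 2 * (w 0 * x 1 - w 1 * x 0)) := by
  rw [det4, Matrix.det_succ_row_zero, Fin.sum_univ_four]
  simp only [Matrix.det_fin_three]
  simp [Fin.succAbove, show (Fin.succ 2 : Fin 4) = 3 from rfl,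
    show (Fin.castSucc 2 : Fin 4) = 2 from rfl]
  ring

theorem sum_eps (f : Fin 4 → Fin 4 → Fin 4 → Fin 4 → ℝ) :
    ∑ I, ∑ J, ∑ K, ∑ L, eps I J K L * f I J K L =
      f 0 1 2 3 - f 0 1 3 2 - f 0 2 1 3 + f 0 2 3 1 + f 0 3 1 2 - f 0 3 2 1
      - f 1 0 2 3 + f 1 0 3 2 + f 1 2 0 3 - f 1 2 3 0 - f 1 3 0 2 + f 1 3 2 0
      + f 2 0 1 3 - f 2 0 3 1 - f 2 1 0 3 + f 2 1 3 0 + f 2 3 0 1 - f 2 3 1 0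
      - f 3 0 1 2 + f 3 0 2 1 + f 3 1 0 2 - f 3 1 2 0 - f 3 2 0 1 + f 3 2 1 0 := by
  simp [Fin.sum_univ_four, eps, show Int.sign 2 = 1 from rfl,
    show Int.sign 3 = 1 from rfl]
  ring

theorem hodge_wedge (u v : R4) : hodge (wedge u v) =
    !![0, u 2 * v 3 - u 3 * v 2, u 3 * v 1 - u 1 * v 3, u 1 * v 2 - u 2 * v 1;
       u 3 * v 2 - u 2 * v 3, 0, u 0 * v 3 - u 3 * v 0, u 2 * v 0 - u 0 * v 2;
       u 1 * v 3 - u 3 * v 1, u 3 * v 0 - u 0 * v 3, 0, u 0 * v 1 - u 1 * v 0;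
       u 2 * v 1 - u 1 * v 2, u 0 * v 2 - u 2 * v 0, u 1 * v 0 - u 0 * v 1, 0] := by
  ext I J
  fin_cases I <;> fin_cases J <;>
    simp [hodge, wedge, Fin.sum_univ_four, eps, show Int.sign 2 = 1 from rfl,
    show Int.sign 3 = 1 from rfl] <;> ring

theorem hodge_hodge_wedge (u v : R4) : hodge (hodge (wedge u v)) = wedge u v := by
  rw [hodge_wedge]
  ext I J
  fin_cases I <;> fin_cases J <;>
    simp [hodge, wedge, Fin.sum_univ_four, eps, show Int.sign 2 = 1 from rfl,
    show Int.sign 3 = 1 from rfl] <;> ring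

theorem dotProduct_hodge_wedge (x y u v : R4) :
    (⇑x) ⬝ᵥ (hodge (wedge u v)).mulVec (⇑y) = det4 x y u v := by
  rw [hodge_wedge, det4_eq]
  simp [Matrix.mulVec, dotProduct, Fin.sum_univ_four]
  ring

theorem bivNorm_hodge_wedge (u v : R4) : bivNorm (hodge (wedge u v)) = bivNorm (wedge u v) := by
  rw [hodge_wedge, bivNorm, bivNorm]
  congr 2
  simp [wedge, Fin.sum_univ_four]
  ring

theorem sum_eps_hodge_wedge (x y z w : R4) :
    ∑ I, ∑ J, ∑ K, ∑ L, eps I J K L * (hodge (wedge x y) I J * hodge (wedge z w) K L) =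
      4 * det4 x y z w := by
  rw [sum_eps, det4_eq, hodge_wedge, hodge_wedge]
  simp
  ring

theorem sum_eps_det4 (e : Fin 4 → R4) :
    ∑ μ, ∑ ν, ∑ ρ, ∑ σ, eps μ ν ρ σ * det4 (e μ) (e ν) (e ρ) (e σ) =
      24 * det4 (e 0) (e 1) (e 2) (e 3) := by
  rw [sum_eps]
  simp only [det4_eq]
  ring

theorem bivNorm_smul (r : ℝ) (X : Bivector) : bivNorm (r • X) = |r| * bivNorm X := by
  rw [bivNorm, bivNorm, ← Real.sqrt_sq_eq_abs, ← Real.sqrt_mul (sq_nonneg r)]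
  congr 1
  simp only [Matrix.smul_apply, smul_eq_mul, mul_pow, ← Finset.mul_sum]
  ring

theorem bivNorm_wedge_pos {u v : R4} (h : wedge u v ≠ 0) : 0 < bivNorm (wedge u v) := by
  rw [bivNorm]
  apply Real.sqrt_pos.2
  by_contra hn
  apply h
  have h0 : ∑ I, ∑ J, wedge u v I J ^ 2 = 0 :=
    le_antisymm (by linarith) (Finset.sum_nonneg fun _ _ => Finset.sum_nonneg fun _ _ => sq_nonneg _)
  ext I J
  have h1 := (Finset.sum_eq_zero_iff_of_nonneg
    (fun _ _ => Finset.sum_nonneg fun _ _ => sq_nonneg _)).1 h0 I (Finset.mem_univ _)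
  have h2 := (Finset.sum_eq_zero_iff_of_nonneg (fun _ _ => sq_nonneg _)).1 h1 J
    (Finset.mem_univ _)
  simpa using h2

theorem wedge_smul_smul (r s : ℝ) (u v : R4) :
    wedge (r • u) (s • v) = (r * s) • wedge u v := by
  ext I J; simp [wedge]; ring

theorem wedge_sum {ι : Type*} (u : R4) (s : Finset ι) (f : ι → R4) :
    wedge u (∑ i ∈ s, f i) = ∑ i ∈ s, wedge u (f i) := by
  ext I J
  simp [wedge, Matrix.sum_apply, Finset.mul_sum, Finset.sum_sub_distrib]

theorem wedge_mulVec (u v z : R4) :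
    WithLp.toLp 2 ((wedge u v).mulVec ⇑z) = inner ℝ v z • u - inner ℝ u z • v := by
  ext I
  simp [wedge, Matrix.mulVec, dotProduct, Fin.sum_univ_four, PiLp.inner_apply]
  fin_cases I <;> simp <;> ring

theorem sum_eq_of_nodup {M : Type*} [AddCommMonoid M] {a b c d e : Fin 5}
    (h : [a, b, c, d, e].Nodup) (f : Fin 5 → M) :
    ∑ i, f i = f a + f b + f c + f d + f e := by
  have hu : ([a, b, c, d, e].toFinset : Finset (Fin 5)) = Finset.univ := by
    apply Finset.eq_univ_of_card
    rw [List.toFinset_card_of_nodup h]; rfl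
  rw [← hu, List.sum_toFinset f h]
  simp [add_assoc]

theorem det4_swap₀₁ (u v w x : R4) : det4 v u w x = -det4 u v w x := by
  simp only [det4_eq]; ring

theorem det4_smul (k l m n : ℝ) (u v w x : R4) :
    det4 (k • u) (l • v) (m • w) (n • x) = k * l * m * n * det4 u v w x := by
  simp only [det4_eq, PiLp.smul_apply, smul_eq_mul]; ring

theorem det4_relation {r s t k l : ℝ} {A B C D E : R4}
    (h : r • A + s • B + t • C + k • D + l • E = 0) :
    r * det4 A C D E + s * det4 B C D E = 0 := by
  have h0 : det4 (r • A + s • B + t • C + k • D + l • E) C D E = 0 := by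
    rw [h, det4_eq]; simp
  rw [← h0]
  simp only [det4_eq, PiLp.add_apply, PiLp.smul_apply, smul_eq_mul]; ring

theorem det4_map (e : R4 →ₗ[ℝ] R4) (u v w x : R4) :
    det4 (e u) (e v) (e w) (e x) =
      det4 (e (EuclideanSpace.single 0 1)) (e (EuclideanSpace.single 1 1))
        (e (EuclideanSpace.single 2 1)) (e (EuclideanSpace.single 3 1)) * det4 u v w x := by
  have key (u : R4) (J : Fin 4) : e u J = u 0 * e (EuclideanSpace.single 0 1) J +
      u 1 * e (EuclideanSpace.single 1 1) J + u 2 * e (EuclideanSpace.single 2 1) J +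
      u 3 * e (EuclideanSpace.single 3 1) J := by
    have hu : u = ∑ I, u I • EuclideanSpace.single I (1 : ℝ) := by
      ext J; simp [Pi.single_apply]
    conv_lhs => rw [hu]
    simp [Fin.sum_univ_four]
  rw [mul_comm, det4, det4, det4, ← Matrix.det_mul]
  congr 1
  ext I J
  fin_cases I <;> simp [Matrix.mul_apply, Fin.sum_univ_four] <;> exact key _ J

theorem inner_eq (x y : R4) :
    inner ℝ x y = x 0 * y 0 + x 1 * y 1 + x 2 * y 2 + x 3 * y 3 := by
  simp [PiLp.inner_apply, Fin.sum_univ_four]; ring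

theorem dotProduct_wedge (x y u v : R4) :
    (⇑x) ⬝ᵥ (wedge u v).mulVec (⇑y) = inner ℝ u x * inner ℝ v y - inner ℝ v x * inner ℝ u y := by
  simp [wedge, Matrix.mulVec, dotProduct, Fin.sum_univ_four, inner_eq]
  ring

/-- A bivector is determined by its values on the pairs of vectors of a basis. -/
theorem eq_of_dotProduct_eq {u : Fin 4 → R4} (hu : det4 (u 0) (u 1) (u 2) (u 3) ≠ 0)
    {X Y : Bivector}
    (h : ∀ i j, (⇑(u i)) ⬝ᵥ X.mulVec ⇑(u j) = (⇑(u i)) ⬝ᵥ Y.mulVec ⇑(u j)) : X = Y := by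
  set U : Matrix (Fin 4) (Fin 4) ℝ := Matrix.of ![⇑(u 0), ⇑(u 1), ⇑(u 2), ⇑(u 3)] with hU
  have hrow (i) : U i = ⇑(u i) := by fin_cases i <;> rfl
  have hdet : IsUnit U.det := isUnit_iff_ne_zero.2 hu
  have hentry (Z : Bivector) (i j) : (U * (Z * U.transpose)) i j =
      (⇑(u i)) ⬝ᵥ Z.mulVec ⇑(u j) := by
    rw [Matrix.mul_apply']
    congr 1
    · exact hrow i
    · ext k
      rw [Matrix.mul_apply', Matrix.mulVec, ← hrow j]
      rfl
  have h1 : U * (X * U.transpose) = U * (Y * U.transpose) := by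
    ext i j; rw [hentry, hentry, h]
  have h2 := (Matrix.isUnit_iff_isUnit_det U).2 hdet
  have h3 : IsUnit U.transpose :=
    (Matrix.isUnit_iff_isUnit_det _).2 (by rwa [Matrix.det_transpose])
  exact h3.mul_right_cancel (h2.mul_left_cancel h1)

/-- If `f, g` are the first two vectors of the basis dual to `u, v, z, w`, then `⋆(z ∧ w)` is
`det(u, v, z, w) f ∧ g`: both bivectors have the same values on the pairs from `u, v, z, w`. -/
theorem hodge_wedge_eq_of_dual {u v z w f g : R4}
    (fu : inner ℝ f u = 1) (fv : inner ℝ f v = 0) (fz : inner ℝ f z = 0) (fw : inner ℝ f w = 0)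
    (gu : inner ℝ g u = 0) (gv : inner ℝ g v = 1) (gz : inner ℝ g z = 0) (gw : inner ℝ g w = 0)
    (hdet : det4 u v z w ≠ 0) :
    hodge (wedge z w) = det4 u v z w • wedge f g := by
  refine eq_of_dotProduct_eq (u := ![u, v, z, w]) hdet fun i j => ?_
  rw [dotProduct_hodge_wedge, Matrix.smul_mulVec, dotProduct_smul, dotProduct_wedge, smul_eq_mul]
  fin_cases i <;> fin_cases j <;>
    simp only [Fin.zero_eta, Fin.mk_one, Fin.reduceFinMk, Matrix.cons_val, fu, fv, fz, fw, gu, gv,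
      gz, gw, mul_zero, sub_zero, zero_sub, mul_one, mul_neg, det4_eq] <;> ring

theorem det4_mul_det4 (u v : Fin 4 → R4) :
    det4 (u 0) (u 1) (u 2) (u 3) * det4 (v 0) (v 1) (v 2) (v 3) =
      Matrix.det (Matrix.of fun i j => inner ℝ (v j) (u i)) := by
  rw [det4, det4, ← Matrix.det_transpose (Matrix.of ![⇑(v 0), ⇑(v 1), ⇑(v 2), ⇑(v 3)]),
    ← Matrix.det_mul]
  congr 1
  ext i j
  fin_cases i <;> fin_cases j <;>
    simp [Matrix.mul_apply, Fin.sum_univ_four, inner_eq] <;> ring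

theorem eq_zero_of_relation {r s t k : ℝ} {A B C D : R4} (hdet : det4 A B C D ≠ 0)
    (h : r • A + s • B + t • C + k • D = 0) : r = 0 ∧ s = 0 ∧ t = 0 ∧ k = 0 := by
  have h0 : ![r, s, t, k] = 0 := by
    refine Matrix.eq_zero_of_vecMul_eq_zero hdet ?_
    ext J
    have := congrArg (fun x : R4 => x J) h
    simpa [Matrix.vecMul, dotProduct, Fin.sum_univ_four] using this
  exact ⟨congrFun h0 0, congrFun h0 1, congrFun h0 2, congrFun h0 3⟩

/-! ### Gradients of barycentric coordinates -/

/-- `g a` is the gradient of the barycentric coordinate of the vertex `q a`. -/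
def IsDual (g q : Fin 5 → R4) : Prop :=
  ∀ a b c, inner ℝ (g a) (q b - q c) = (if b = a then 1 else 0) - (if c = a then 1 else 0)

/-- `4!` times the volume of the simplex with vertices `q`, as the modulus of the determinant of
the homogeneous coordinates of the vertices. -/
noncomputable def vol (q : Fin 5 → R4) : ℝ :=
  |Matrix.det (Matrix.of fun i : Fin 5 => (Fin.cons 1 ⇑(q i) : Fin 5 → ℝ))|

/-- The determinants of `PositiveOrder` all have the same modulus: each is the determinant of the
homogeneous coordinates of the vertices in another order, expanded along the column of ones. -/
theorem abs_det4_eq_vol (q : Fin 5 → R4) {a b c d e : Fin 5} (h : [a, b, c, d, e].Nodup) :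
    |det4 (q c - q a) (q c - q b) (q d - q c) (q e - q c)| = vol q := by
  have hinj : Function.Injective ![a, b, c, d, e] := by
    have h' : (List.ofFn ![a, b, c, d, e]).Nodup := h
    exact List.nodup_ofFn.1 h'
  let σ : Equiv.Perm (Fin 5) := Equiv.ofBijective _ (Finite.injective_iff_bijective.1 hinj)
  have h1 := Matrix.det_permute σ
    (Matrix.of fun i : Fin 5 => (Fin.cons 1 ⇑(q i) : Fin 5 → ℝ))
  have h2 : |Matrix.det ((Matrix.of fun i : Fin 5 =>
      (Fin.cons 1 ⇑(q i) : Fin 5 → ℝ)).submatrix σ id)| = vol q := by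
    rw [h1, abs_mul]
    rcases Int.units_eq_one_or (Equiv.Perm.sign σ) with h | h <;> simp [h, vol]
  rw [← h2]
  congr 1
  rw [Matrix.det_succ_column_zero]
  have hσ : (σ 0 = a ∧ σ 1 = b ∧ σ 2 = c) ∧ σ 3 = d ∧ σ 4 = e := ⟨⟨rfl, rfl, rfl⟩, rfl, rfl⟩
  obtain ⟨⟨h0, h1, h2⟩, h3, h4⟩ := hσ
  have hm (i : Fin 5) : Matrix.submatrix ((Matrix.of fun i : Fin 5 =>
      (Fin.cons 1 ⇑(q i) : Fin 5 → ℝ)).submatrix σ id) i.succAbove Fin.succ =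
      Matrix.of ![⇑(q (σ (i.succAbove 0))), ⇑(q (σ (i.succAbove 1))), ⇑(q (σ (i.succAbove 2))),
        ⇑(q (σ (i.succAbove 3)))] := by
    ext k l
    fin_cases k <;> simp
  have hm' (i : Fin 5) : Matrix.det (Matrix.submatrix ((Matrix.of fun i : Fin 5 =>
      (Fin.cons 1 ⇑(q i) : Fin 5 → ℝ)).submatrix σ id) i.succAbove Fin.succ) =
      det4 (q (σ (i.succAbove 0))) (q (σ (i.succAbove 1))) (q (σ (i.succAbove 2)))
        (q (σ (i.succAbove 3))) := by rw [hm, det4]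
  simp only [hm', Fin.sum_univ_five]
  simp [Fin.succAbove, h0, h1, h2, h3, h4, show (Fin.succ 2 : Fin 5) = 3 from rfl,
    show (Fin.castSucc 2 : Fin 5) = 2 from rfl, show (Fin.succ 3 : Fin 5) = 4 from rfl,
    show (Fin.castSucc 3 : Fin 5) = 3 from rfl]
  simp only [det4_eq, PiLp.sub_apply]
  ring

namespace IsDual

variable {g q : Fin 5 → R4}

theorem det4_mul_eq_one (hg : IsDual g q) {a b c d e : Fin 5} (h : [a, b, c, d, e].Nodup) :
    det4 (q c - q a) (q c - q b) (q d - q c) (q e - q c) * det4 (g a) (g b) (g d) (g e) = 1 := by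
  have := det4_mul_det4 ![q c - q a, q c - q b, q d - q c, q e - q c] ![g a, g b, g d, g e]
  simp only [List.nodup_cons, List.mem_cons, List.not_mem_nil, or_false, not_or,
    List.nodup_nil, not_false_eq_true, and_true] at h
  obtain ⟨⟨h1, h2, h3, h4⟩, ⟨h5, h6, h7⟩, ⟨h8, h9⟩, h10⟩ := h
  refine (Eq.trans ?_ this).trans ?_
  · simp
  have hM : (Matrix.of fun i j => inner ℝ (![g a, g b, g d, g e] j)
      (![q c - q a, q c - q b, q d - q c, q e - q c] i)) = Matrix.diagonal ![-1, -1, 1, 1] := by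
    ext i j
    fin_cases i <;> fin_cases j <;> simp [hg _ _ _, *, Ne.symm, eq_comm]
  rw [hM, Matrix.det_diagonal]
  simp [Fin.prod_univ_four]

/-- The Hodge dual of the triangle `Δ_{ab}` is a multiple of `g a ∧ g b`. -/
theorem hodge_wedge_eq (hg : IsDual g q) {a b c d e : Fin 5} (h : [a, b, c, d, e].Nodup) :
    hodge (wedge (q d - q c) (q e - q c)) =
      det4 (q c - q a) (q c - q b) (q d - q c) (q e - q c) • wedge (g a) (g b) := by
  have hdet := left_ne_zero_of_mul_eq_one (hg.det4_mul_eq_one h)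
  have hw : wedge (g a) (g b) = wedge (-g a) (-g b) := by ext I J; simp [wedge]
  rw [hw]
  simp only [List.nodup_cons, List.mem_cons, List.not_mem_nil, or_false, not_or,
    List.nodup_nil, not_false_eq_true, and_true] at h
  obtain ⟨⟨h1, h2, h3, h4⟩, ⟨h5, h6, h7⟩, ⟨h8, h9⟩, h10⟩ := h
  apply hodge_wedge_eq_of_dual _ _ _ _ _ _ _ _ hdet <;>
    simp [hg _ _ _, *, Ne.symm, eq_comm]

theorem vol_pos (hg : IsDual g q) : 0 < vol q := by
  rw [← abs_det4_eq_vol q (a := 0) (b := 1) (c := 2) (d := 3) (e := 4) (by decide)]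
  exact abs_pos.2 (left_ne_zero_of_mul_eq_one (hg.det4_mul_eq_one (by decide)))

/-- A vector is determined by its inner products with the edges of the simplex. -/
theorem eq_of_inner_eq (hg : IsDual g q) {x y : R4}
    (h : ∀ b c, inner ℝ x (q b - q c) = inner ℝ y (q b - q c)) : x = y := by
  have hdet := left_ne_zero_of_mul_eq_one
    (hg.det4_mul_eq_one (a := 0) (b := 1) (c := 2) (d := 3) (e := 4) (by decide))
  have h0 : (⇑(x - y) : Fin 4 → ℝ) = 0 := by
    refine Matrix.eq_zero_of_mulVec_eq_zero hdet ?_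
    have h' (b c) : inner ℝ (x - y) (q b - q c) = 0 := by rw [inner_sub_left, h, sub_self]
    ext i
    fin_cases i
    · simpa [Matrix.mulVec, dotProduct, Fin.sum_univ_four, inner_eq, mul_comm] using h' 2 0
    · simpa [Matrix.mulVec, dotProduct, Fin.sum_univ_four, inner_eq, mul_comm] using h' 2 1
    · simpa [Matrix.mulVec, dotProduct, Fin.sum_univ_four, inner_eq, mul_comm] using h' 3 2
    · simpa [Matrix.mulVec, dotProduct, Fin.sum_univ_four, inner_eq, mul_comm] using h' 4 2
  rw [← sub_eq_zero]
  ext i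
  exact congrFun h0 i

theorem sum_eq_zero (hg : IsDual g q) : ∑ a, g a = 0 := by
  refine hg.eq_of_inner_eq fun b c => ?_
  simp [sum_inner, hg _ _ _]

/-- The vectors orthogonal to a facet are the multiples of the gradient. -/
theorem eq_smul_of_orthogonal (hg : IsDual g q) {a : Fin 5} {x : R4}
    (h : ∀ c d, c ≠ a → d ≠ a → inner ℝ x (q c - q d) = 0) {c : Fin 5} (hc : c ≠ a) :
    x = inner ℝ x (q a - q c) • g a := by
  have key (b) : inner ℝ x (q b - q c) = if b = a then inner ℝ x (q a - q c) else 0 := by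
    split_ifs with hb
    · rw [hb]
    · exact h b c hb hc
  refine hg.eq_of_inner_eq fun b d => ?_
  have : q b - q d = (q b - q c) - (q d - q c) := by abel
  rw [real_inner_smul_left, hg, this, inner_sub_right, key b, key d]
  split_ifs <;> simp

theorem affineIndependent (hg : IsDual g q) : AffineIndependent ℝ q := by
  rw [affineIndependent_iff_linearIndependent_vsub ℝ q 0, linearIndependent_iff']
  intro s w hw i hi
  have h := congrArg (fun x => inner ℝ (g i) x) hw
  simp only [vsub_eq_sub, inner_sum, real_inner_smul_right, hg _ _ _, inner_zero_right] at h
  rw [Finset.sum_eq_single i] at h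
  · simpa [i.2.symm] using h
  · intro j _ hj
    have h1 : (j : Fin 5) ≠ i := fun e => hj (Subtype.ext e)
    simp [h1, i.2.symm]
  · exact fun h => absurd hi h

theorem smul (hg : IsDual g q) {r : ℝ} (hr : r ≠ 0) :
    IsDual (fun a => r⁻¹ • g a) (fun a => r • q a) := by
  intro a b c
  rw [← smul_sub, real_inner_smul_left, real_inner_smul_right, inv_mul_cancel_left₀ hr, hg]

end IsDual

theorem exists_isDual {q : Fin 5 → R4} (hq : AffineIndependent ℝ q) : ∃ g, IsDual g q := by
  have htop : affineSpan ℝ (Set.range q) = ⊤ := by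
    rw [hq.affineSpan_eq_top_iff_card_eq_finrank_add_one]; simp
  let b : AffineBasis (Fin 5) ℝ R4 := ⟨q, hq, htop⟩
  refine ⟨fun a => (InnerProductSpace.toDual ℝ R4).symm
    (LinearMap.toContinuousLinearMap (b.coord a).linear), fun a i j => ?_⟩
  have h1 := (b.coord a).linearMap_vsub (q i) (q j)
  rw [InnerProductSpace.toDual_symm_apply]
  simp only [vsub_eq_sub] at h1
  have h2 (i) : b.coord a (q i) = if i = a then 1 else 0 := by
    have := b.coord_apply a i
    rw [show b i = q i from rfl] at this
    rw [this]; simp [eq_comm]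
  rw [h2, h2] at h1
  exact h1

/-- Minkowski-type reconstruction: five covectors adding up to zero, four of which are
independent, are the gradients of the barycentric coordinates of a simplex. -/
theorem exists_isDual_of_sum_eq_zero {M : Fin 5 → R4} (hM : ∑ i, M i = 0) {a b c d e : Fin 5}
    (h : [a, b, c, d, e].Nodup) (hdet : det4 (M b) (M c) (M d) (M e) ≠ 0) :
    ∃ q, IsDual M q := by
  have key (i : Fin 5) : ∃ x : R4, ∀ r, inner ℝ (M r) x =
      (if i = r then 1 else 0) - (if a = r then 1 else 0) := by
    set y : Fin 5 → ℝ := fun r => (if i = r then 1 else 0) - (if a = r then 1 else 0) with hy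
    have hy0 : ∑ r, y r = 0 := by simp [hy]
    set U : Matrix (Fin 4) (Fin 4) ℝ := Matrix.of ![⇑(M b), ⇑(M c), ⇑(M d), ⇑(M e)] with hU
    have hu : IsUnit U.det := isUnit_iff_ne_zero.2 hdet
    let x : R4 := WithLp.toLp 2 (U⁻¹.mulVec ![y b, y c, y d, y e])
    have hx : U.mulVec ⇑x = ![y b, y c, y d, y e] := by
      rw [show (⇑x : Fin 4 → ℝ) = U⁻¹.mulVec ![y b, y c, y d, y e] from rfl, Matrix.mulVec_mulVec,
        Matrix.mul_nonsing_inv _ hu, Matrix.one_mulVec]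
    have hb : inner ℝ (M b) x = y b := by
      simpa [hU, Matrix.mulVec, dotProduct, Fin.sum_univ_four, inner_eq] using congrFun hx 0
    have hc : inner ℝ (M c) x = y c := by
      simpa [hU, Matrix.mulVec, dotProduct, Fin.sum_univ_four, inner_eq] using congrFun hx 1
    have hd : inner ℝ (M d) x = y d := by
      simpa [hU, Matrix.mulVec, dotProduct, Fin.sum_univ_four, inner_eq] using congrFun hx 2
    have he : inner ℝ (M e) x = y e := by
      simpa [hU, Matrix.mulVec, dotProduct, Fin.sum_univ_four, inner_eq] using congrFun hx 3
    have ha : inner ℝ (M a) x = y a := by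
      have h1 : ∑ r, inner ℝ (M r) x = 0 := by rw [← sum_inner, hM, inner_zero_left]
      rw [sum_eq_of_nodup h] at h1 hy0
      linarith
    refine ⟨x, fun r => ?_⟩
    have hr : r ∈ [a, b, c, d, e] := by
      have hu : [a, b, c, d, e].toFinset = Finset.univ := by
        apply Finset.eq_univ_of_card
        rw [List.toFinset_card_of_nodup h]; rfl
      exact List.mem_toFinset.1 (hu ▸ Finset.mem_univ r)
    simp only [List.mem_cons, List.not_mem_nil, or_false] at hr
    rcases hr with rfl | rfl | rfl | rfl | rfl <;> assumption
  choose q hq using key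
  refine ⟨q, fun r i j => ?_⟩
  rw [inner_sub_right, hq, hq]; ring

/-! ### Geometrical bivectors -/

theorem others_nodup : ∀ a b : Fin 5, a ≠ b →
    [a, b, others a b 0, others a b 1, others a b 2].Nodup := by
  decide

theorem exists_nodup : ∀ c d e : Fin 5, [c, d, e].Nodup → ∃ a b, [a, b, c, d, e].Nodup := by
  decide

theorem exists_ne_ne (a b : Fin 5) : ∃ c, c ≠ a ∧ c ≠ b := by
  revert a b; decide

namespace IsDual

variable {g q : Fin 5 → R4}

theorem wedge_ne_zero (hg : IsDual g q) {a b : Fin 5} (hab : a ≠ b) : wedge (g a) (g b) ≠ 0 := by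
  intro h
  obtain ⟨c, hca, hcb⟩ := exists_ne_ne a b
  have := dotProduct_wedge (q a - q c) (q b - q c) (g a) (g b)
  rw [h] at this
  simp [hg _ _ _, hca, hcb, hab] at this

theorem isOutwardNormal (hg : IsDual g q) (a : Fin 5) :
    IsOutwardNormal q a ((-‖g a‖⁻¹) • g a) := by
  have h0 : g a ≠ 0 := by
    intro h
    obtain ⟨c, hc, -⟩ := exists_ne_ne a a
    have := hg a a c
    rw [h] at this
    simp [hc] at this
  have hpos : 0 < ‖g a‖⁻¹ := inv_pos.2 (norm_pos_iff.2 h0)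
  refine ⟨?_, fun c d hc hd => ?_, fun c hc => ?_⟩
  · rw [norm_smul, norm_neg, norm_inv, norm_norm, inv_mul_cancel₀ (norm_ne_zero_iff.2 h0)]
  · simp [real_inner_smul_left, hg _ _ _, hc, hd]
  · simpa [real_inner_smul_left, hg _ _ _, hc] using h0

theorem exists_neg_smul_of_isOutwardNormal (hg : IsDual g q) {a : Fin 5} {N : R4}
    (hN : IsOutwardNormal q a N) : ∃ t : ℝ, t < 0 ∧ N = t • g a := by
  obtain ⟨c, hc, -⟩ := exists_ne_ne a a
  exact ⟨_, hN.2.2 c hc, hg.eq_smul_of_orthogonal hN.2.1 hc⟩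

theorem geomBivector_eq (hg : IsDual g q) {N : Fin 5 → R4} (hN : ∀ a, IsOutwardNormal q a (N a))
    {a b : Fin 5} (hab : a ≠ b) : geomBivector q N a b = (vol q / 2) • wedge (g a) (g b) := by
  obtain ⟨s, hs, hNa⟩ := hg.exists_neg_smul_of_isOutwardNormal (hN a)
  obtain ⟨t, ht, hNb⟩ := hg.exists_neg_smul_of_isOutwardNormal (hN b)
  have hst : 0 < s * t := mul_pos_of_neg_of_neg hs ht
  have hw := bivNorm_wedge_pos (hg.wedge_ne_zero hab)
  have harea : triangleArea q a b = vol q * bivNorm (wedge (g a) (g b)) / 2 := by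
    have hn := others_nodup a b hab
    rw [triangleArea, ← bivNorm_hodge_wedge, hg.hodge_wedge_eq hn, bivNorm_smul,
      abs_det4_eq_vol q hn]
  rw [geomBivector, hNa, hNb, wedge_smul_smul, bivNorm_smul, abs_of_pos hst, harea, smul_smul]
  congr 1
  have hs0 := hs.ne
  have ht0 := ht.ne
  field_simp

end IsDual

/-- The geometrical bivectors of a simplex are, up to the factor `vol q / 2`, the wedge products
of the gradients of its barycentric coordinates. -/
theorem hasReconstructionSign_one_iff (𝓑 : Fin 5 → Fin 5 → Bivector) :
    HasReconstructionSign 𝓑 1 ↔ ∃ g q, IsDual g q ∧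
      ∀ a b, a ≠ b → 𝓑 a b = (vol q / 2) • wedge (g a) (g b) := by
  constructor
  · rintro ⟨q, N, hq, hN, h⟩
    obtain ⟨g, hg⟩ := exists_isDual hq
    refine ⟨g, q, hg, fun a b hab => ?_⟩
    rw [h a b hab, one_smul, hg.geomBivector_eq hN hab]
  · rintro ⟨g, q, hg, h⟩
    refine ⟨q, _, hg.affineIndependent, hg.isOutwardNormal, fun a b hab => ?_⟩
    rw [h a b hab, one_smul, hg.geomBivector_eq hg.isOutwardNormal hab]

/-! ### Constant two-forms -/

/-- The two-form with values `f u v`. -/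
noncomputable def twoFormOfBilin (f : R4 →ₗ[ℝ] R4 →ₗ[ℝ] Bivector) (hf : ∀ u, f u u = 0) :
    TwoForm where
  toFun m := f (m 0) (m 1)
  map_update_add' m i x y := by fin_cases i <;> simp
  map_update_smul' m i c x := by fin_cases i <;> simp
  map_eq_zero_of_eq' m i j h hij := by
    fin_cases i <;> fin_cases j <;> simp_all

theorem twoFormOfBilin_apply (f : R4 →ₗ[ℝ] R4 →ₗ[ℝ] Bivector) (hf : ∀ u, f u u = 0) (u v : R4) :
    twoFormOfBilin f hf ![u, v] = f u v := rfl

theorem positiveOrder_iff {p : Fin 5 → R4} {a b c d e : Fin 5} : PositiveOrder p a b c d e ↔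
    0 < det4 (p c - p a) (p c - p b) (p d - p c) (p e - p c) := Iff.rfl

theorem exists_positiveOrder {p : Fin 5 → R4} (hp : AffineIndependent ℝ p) {a b : Fin 5}
    (hab : a ≠ b) : ∃ c d e, [a, b, c, d, e].Nodup ∧ PositiveOrder p a b c d e := by
  obtain ⟨g, hg⟩ := exists_isDual hp
  have hn := others_nodup a b hab
  generalize others a b 0 = c at hn
  generalize others a b 1 = d at hn
  generalize others a b 2 = e at hn
  have h0 := left_ne_zero_of_mul_eq_one (hg.det4_mul_eq_one hn)
  rcases h0.lt_or_gt with h | h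
  · refine ⟨c, e, d, ?_, ?_⟩
    · refine (List.Perm.nodup_iff ?_).1 hn
      exact ((((List.Perm.swap e d []).cons c).cons b).cons a)
    · rw [positiveOrder_iff]
      have : det4 (p c - p a) (p c - p b) (p e - p c) (p d - p c) =
          -det4 (p c - p a) (p c - p b) (p d - p c) (p e - p c) := by
        simp only [det4_eq]; ring
      linarith
  · exact ⟨c, d, e, hn, h⟩

theorem IsContinuumForm.value {p : Fin 5 → R4} {𝓑 : Fin 5 → Fin 5 → Bivector} {B : TwoForm}
    (h : IsContinuumForm p 𝓑 B) {a b c d e : Fin 5} (hn : [a, b, c, d, e].Nodup)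
    (hpos : PositiveOrder p a b c d e) : B ![p d - p c, p e - p c] = (2 : ℝ) • 𝓑 a b := by
  rw [← h.2 a b c d e hn hpos, triangleIntegral_const, smul_smul]
  norm_num

theorem IsContinuumForm.congr {p : Fin 5 → R4} {𝓑 𝓑' : Fin 5 → Fin 5 → Bivector} {B : TwoForm}
    (h : IsContinuumForm p 𝓑 B) (h𝓑 : ∀ a b, a ≠ b → 𝓑 a b = 𝓑' a b) :
    IsContinuumForm p 𝓑' B := by
  refine ⟨h.1, fun a b c d e hn hpos => ?_⟩
  rw [h.2 a b c d e hn hpos]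
  exact h𝓑 a b (by rintro rfl; simp at hn)

theorem IsContinuumForm.unique {p : Fin 5 → R4} (hp : AffineIndependent ℝ p)
    {𝓑 : Fin 5 → Fin 5 → Bivector} {B B' : TwoForm} (h : IsContinuumForm p 𝓑 B)
    (h' : IsContinuumForm p 𝓑 B') : B = B' := by
  obtain ⟨g, hg⟩ := exists_isDual hp
  have key (c d e : Fin 5) (hcde : [c, d, e].Nodup) :
      B ![p d - p c, p e - p c] = B' ![p d - p c, p e - p c] := by
    obtain ⟨a, b, hn⟩ := exists_nodup c d e hcde
    have h0 := left_ne_zero_of_mul_eq_one (hg.det4_mul_eq_one hn)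
    rcases h0.lt_or_gt with hlt | hgt
    · have hn' : [b, a, c, d, e].Nodup :=
        (List.Perm.nodup_iff (List.Perm.swap b a [c, d, e])).1 hn
      have hpos : PositiveOrder p b a c d e := by
        rw [positiveOrder_iff, det4_swap₀₁]; linarith
      rw [h.value hn' hpos, h'.value hn' hpos]
    · rw [h.value hn hgt, h'.value hn hgt]
  have hli := (affineIndependent_iff_linearIndependent_vsub ℝ p 0).1 hp
  let β := basisOfLinearIndependentOfCardEqFinrank' _ hli (by simp)
  refine β.ext_alternating fun v hv => ?_
  have hβ : (fun i => β (v i)) = ![p (v 0) - p 0, p (v 1) - p 0] := by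
    ext1 i
    fin_cases i <;> simp [β]
  rw [hβ]
  refine key 0 _ _ ?_
  have h01 : (v 0 : Fin 5) ≠ v 1 := fun h => by
    have := hv (Subtype.ext h); simp at this
  simp [(v 0).2.symm, (v 1).2.symm, h01]

/-- The form `B(u, v) = (1/V) ∑_{a,b} det(p_a, p_b, u, v) 𝓑_{ab}`. By closure the determinants may
be computed with any base point, and with base point `p c` only the pairs `(a, b)` and `(b, a)`
contribute to the value on the edges of `Δ_{ab}` issuing from `p c`. -/
theorem exists_isContinuumForm {p : Fin 5 → R4} (hp : AffineIndependent ℝ p)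
    {𝓑 : Fin 5 → Fin 5 → Bivector} (hso : ∀ a b, (𝓑 a b).transpose = -𝓑 a b)
    (hanti : ∀ a b, 𝓑 b a = -𝓑 a b) (hcl : ∀ a, ∑ b, 𝓑 a b = 0) :
    ∃ B, IsContinuumForm p 𝓑 B := by
  obtain ⟨g, hg⟩ := exists_isDual hp
  have hvol := hg.vol_pos
  let f : R4 →ₗ[ℝ] R4 →ₗ[ℝ] Bivector :=
    LinearMap.mk₂ ℝ (fun u v => ∑ a, ∑ b, ((vol p)⁻¹ * det4 (p a) (p b) u v) • 𝓑 a b)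
      (fun u u' v => by
        simp only [← Finset.sum_add_distrib, ← add_smul]
        refine Finset.sum_congr rfl fun a _ => Finset.sum_congr rfl fun b _ => ?_
        congr 1; simp only [det4_eq, PiLp.add_apply]; ring)
      (fun r u v => by
        simp only [Finset.smul_sum, smul_smul]
        refine Finset.sum_congr rfl fun a _ => Finset.sum_congr rfl fun b _ => ?_
        congr 1; simp only [det4_eq, PiLp.smul_apply, smul_eq_mul]; ring)
      (fun u v v' => by
        simp only [← Finset.sum_add_distrib, ← add_smul]
        refine Finset.sum_congr rfl fun a _ => Finset.sum_congr rfl fun b _ => ?_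
        congr 1; simp only [det4_eq, PiLp.add_apply]; ring)
      (fun r u v => by
        simp only [Finset.smul_sum, smul_smul]
        refine Finset.sum_congr rfl fun a _ => Finset.sum_congr rfl fun b _ => ?_
        congr 1; simp only [det4_eq, PiLp.smul_apply, smul_eq_mul]; ring)
  have hf (u v) : f u v = ∑ a, ∑ b, ((vol p)⁻¹ * det4 (p a) (p b) u v) • 𝓑 a b := rfl
  have hf0 (u) : f u u = 0 := by
    rw [hf]
    refine Finset.sum_eq_zero fun a _ => Finset.sum_eq_zero fun b _ => ?_
    have : det4 (p a) (p b) u u = 0 := by rw [det4_eq]; ring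
    rw [this, mul_zero, zero_smul]
  refine ⟨twoFormOfBilin f hf0, fun u v => ?_, fun a b c d e hn hpos => ?_⟩
  · rw [twoFormOfBilin_apply, hf]
    simp only [Matrix.transpose_sum, Matrix.transpose_smul, hso, smul_neg, Finset.sum_neg_distrib]
  · rw [triangleIntegral_const, twoFormOfBilin_apply]
    set u := p d - p c with hu
    set v := p e - p c with hv
    have hcl' (b) : ∑ a, 𝓑 a b = 0 := by
      rw [← neg_eq_zero, ← Finset.sum_neg_distrib, ← hcl b]
      exact Finset.sum_congr rfl fun a _ => (hanti a b).symm
    have hshift : f u v =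
        ∑ a, ∑ b, ((vol p)⁻¹ * det4 (p a - p c) (p b - p c) u v) • 𝓑 a b := by
      have e1 : ∑ a, ∑ b, ((vol p)⁻¹ * det4 (p a) (p c) u v) • 𝓑 a b = 0 := by
        simp [← Finset.smul_sum, hcl]
      have e2 : ∑ a, ∑ b, ((vol p)⁻¹ * det4 (p c) (p b) u v) • 𝓑 a b = 0 := by
        rw [Finset.sum_comm]
        simp [← Finset.smul_sum, hcl']
      rw [hf, ← sub_zero (∑ a, _), ← e1, ← sub_zero (_ - _), ← e2]
      simp only [← Finset.sum_sub_distrib, ← sub_smul]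
      refine Finset.sum_congr rfl fun a _ => Finset.sum_congr rfl fun b _ => ?_
      congr 1
      simp only [det4_eq, PiLp.sub_apply]; ring
    have hV : det4 (p a - p c) (p b - p c) u v = vol p := by
      rw [← abs_det4_eq_vol p hn, abs_of_pos (positiveOrder_iff.1 hpos)]
      simp only [det4_eq, hu, hv, PiLp.sub_apply]; ring
    have hV' : det4 (p b - p c) (p a - p c) u v = -vol p := by
      rw [det4_swap₀₁, hV]
    have z1 (x) : det4 (p d - p c) x u v = 0 := by rw [← hu, det4_eq]; ring
    have z2 (x) : det4 (p e - p c) x u v = 0 := by rw [← hv, det4_eq]; ring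
    have z3 (x) : det4 x (p d - p c) u v = 0 := by rw [← hu, det4_eq]; ring
    have z4 (x) : det4 x (p e - p c) u v = 0 := by rw [← hv, det4_eq]; ring
    have z5 (x) : det4 (p c - p c) x u v = 0 := by simp [det4_eq]
    have z6 (x) : det4 x (p c - p c) u v = 0 := by simp [det4_eq]
    have z7 (x) : det4 x x u v = 0 := by rw [det4_eq]; ring
    rw [hshift]
    simp only [sum_eq_of_nodup hn, z1, z2, z3, z4, z5, z6, z7, hV, hV', mul_zero, zero_smul,
      add_zero, zero_add, hanti a b]
    rw [mul_neg, inv_mul_cancel₀ hvol.ne']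
    module

/-! ### The Einstein–Hilbert sector -/

/-- The determinant of a linear map of `ℝ⁴`, as the determinant of the images of the standard
basis vectors. -/
noncomputable def mapDet (e : R4 →ₗ[ℝ] R4) : ℝ :=
  det4 (e (EuclideanSpace.single 0 1)) (e (EuclideanSpace.single 1 1))
    (e (EuclideanSpace.single 2 1)) (e (EuclideanSpace.single 3 1))

theorem scalar_eq {B : TwoForm} {s : ℝ} {e : R4 →ₗ[ℝ] R4}
    (h : ∀ u v : R4, B ![u, v] = s • hodge (wedge (e u) (e v))) :
    B.scalar = 96 * s ^ 2 * mapDet e := by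
  have h1 (μ ν ρ σ : Fin 4) : ∑ I, ∑ J, ∑ K, ∑ L,
      eps μ ν ρ σ * eps I J K L * B.comp μ ν I J * B.comp ρ σ K L =
      4 * s ^ 2 * (eps μ ν ρ σ * det4 (e (EuclideanSpace.single μ 1))
        (e (EuclideanSpace.single ν 1)) (e (EuclideanSpace.single ρ 1))
        (e (EuclideanSpace.single σ 1))) := by
    have h2 := sum_eps_hodge_wedge (e (EuclideanSpace.single μ 1))
        (e (EuclideanSpace.single ν 1)) (e (EuclideanSpace.single ρ 1))
        (e (EuclideanSpace.single σ 1))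
    rw [show ∀ x y : ℝ, 4 * s ^ 2 * (x * y) = s ^ 2 * x * (4 * y) by intros; ring, ← h2]
    simp only [Finset.mul_sum]
    refine Finset.sum_congr rfl fun I _ => Finset.sum_congr rfl fun J _ =>
      Finset.sum_congr rfl fun K _ => Finset.sum_congr rfl fun L _ => ?_
    simp only [TwoForm.comp, h, Matrix.smul_apply, smul_eq_mul]
    ring
  rw [TwoForm.scalar]
  simp only [h1, ← Finset.mul_sum]
  rw [sum_eps_det4 fun μ => e (EuclideanSpace.single μ 1), mapDet]
  ring

theorem injective_of_mapDet_ne_zero {e : R4 →ₗ[ℝ] R4} (he : mapDet e ≠ 0) :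
    Function.Injective e := by
  rw [← LinearMap.ker_eq_bot, LinearMap.ker_eq_bot']
  intro x hx
  have hx' : x = x 0 • EuclideanSpace.single 0 (1 : ℝ) + x 1 • EuclideanSpace.single 1 (1 : ℝ) +
      x 2 • EuclideanSpace.single 2 (1 : ℝ) + x 3 • EuclideanSpace.single 3 (1 : ℝ) := by
    ext J; fin_cases J <;> simp
  rw [hx'] at hx
  simp only [map_add, map_smul] at hx
  obtain ⟨h0, h1, h2, h3⟩ := eq_zero_of_relation he hx
  ext J; fin_cases J <;> assumption

theorem hodge_neg (X : Bivector) : hodge (-X) = -hodge X := by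
  ext I J; simp [hodge]

/-- The cubic invariant `tr (F₀₁ F₁₂ F₂₀)` of the bivectors `F_{ij} = x_i ∧ x_j` is the Gram
determinant of `x₀, x₁, x₂`, here a sum of squares of minors; in particular it is nonnegative. -/
theorem trace_wedge_mul_wedge_mul_wedge (x y z : R4) :
    Matrix.trace (wedge x y * wedge y z * wedge z x) =
      ∑ I, det4 x y z (EuclideanSpace.single I 1) ^ 2 := by
  simp [Matrix.trace, Matrix.mul_apply, wedge, Fin.sum_univ_four, det4_eq]
  ring

/-- The sectors (II+) and (II-) are disjoint on nondegenerate forms: the cubic invariant of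
`trace_wedge_mul_wedge_mul_wedge` would be nonnegative for both, while it changes sign. -/
theorem mapDet_eq_zero_of_wedge_eq_neg {e f : R4 →ₗ[ℝ] R4}
    (h : ∀ u v, wedge (e u) (e v) = -wedge (f u) (f v)) : mapDet e = 0 := by
  set x := e (EuclideanSpace.single 0 1)
  set y := e (EuclideanSpace.single 1 1)
  set z := e (EuclideanSpace.single 2 1)
  set w := e (EuclideanSpace.single 3 1)
  have h1 : ∑ I, det4 x y z (EuclideanSpace.single I 1) ^ 2 ≤ 0 := by
    rw [← trace_wedge_mul_wedge_mul_wedge, h, h, h]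
    simp only [neg_mul, mul_neg, neg_neg, Matrix.trace_neg]
    rw [trace_wedge_mul_wedge_mul_wedge, neg_nonpos]
    exact Finset.sum_nonneg fun _ _ => sq_nonneg _
  have h2 := (Finset.sum_eq_zero_iff_of_nonneg fun _ _ => sq_nonneg _).1
    (le_antisymm h1 (Finset.sum_nonneg fun _ _ => sq_nonneg _))
  have h3 (I : Fin 4) : det4 x y z (EuclideanSpace.single I 1) = 0 := by
    simpa using h2 I (Finset.mem_univ I)
  have h4 : mapDet e = ∑ I, w I * det4 x y z (EuclideanSpace.single I 1) := by
    change det4 x y z w = _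
    simp [Fin.sum_univ_four, det4_eq]
    ring
  rw [h4]
  simp [h3]

/-- A nondegenerate form `s ⋆(e ∧ e)`, `s = ±1`, has `ν = s`, and `ω` is the sign of `det e`. -/
theorem sector_mul_orientation_eq_one_iff (B : TwoForm) :
    B.sector * B.orientation = 1 ↔ ∃ (s : ℝ) (e : R4 →ₗ[ℝ] R4), (s = 1 ∨ s = -1) ∧
      0 < s * mapDet e ∧ ∀ u v : R4, B ![u, v] = s • hodge (wedge (e u) (e v)) := by
  constructor
  · intro h
    have h0 : B.scalar ≠ 0 := by
      intro h0; simp [TwoForm.sector, h0] at h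
    by_cases h1 : B.InSectorII 1
    · obtain ⟨e, he⟩ := h1
      refine ⟨1, e, Or.inl rfl, ?_, he⟩
      rw [TwoForm.sector, if_neg h0, if_pos ⟨e, he⟩, one_mul, TwoForm.orientation] at h
      rcases h0.lt_or_gt with hn | hp
      · rw [Real.sign_of_neg hn] at h; norm_num at h
      · rw [scalar_eq he] at hp; linarith
    · by_cases h2 : B.InSectorII (-1)
      · obtain ⟨e, he⟩ := h2
        refine ⟨-1, e, Or.inr rfl, ?_, he⟩
        rw [TwoForm.sector, if_neg h0, if_neg h1, if_pos ⟨e, he⟩, TwoForm.orientation] at h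
        rcases h0.lt_or_gt with hn | hp
        · rw [scalar_eq he] at hn; linarith
        · rw [Real.sign_of_pos hp] at h; norm_num at h
      · simp [TwoForm.sector, h0, h1, h2] at h
  · rintro ⟨s, e, hs, hpos, he⟩
    have hsc := scalar_eq he
    have hd : mapDet e ≠ 0 := by rintro h0; simp [h0] at hpos
    rcases hs with rfl | rfl
    · have hpos' : 0 < B.scalar := by rw [hsc]; linarith
      rw [TwoForm.sector, if_neg hpos'.ne', if_pos ⟨e, he⟩, TwoForm.orientation,
        Real.sign_of_pos hpos', one_mul]
    · have hneg : B.scalar < 0 := by rw [hsc]; linarith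
      have h1 : ¬ B.InSectorII 1 := by
        rintro ⟨f, hf⟩
        refine hd (mapDet_eq_zero_of_wedge_eq_neg (f := f) fun u v => ?_)
        have := (he u v).symm.trans (hf u v)
        rw [one_smul, neg_one_smul, neg_eq_iff_eq_neg] at this
        rw [← hodge_hodge_wedge, this, hodge_neg, hodge_hodge_wedge]
      rw [TwoForm.sector, if_neg hneg.ne, if_neg h1, if_pos ⟨e, he⟩, TwoForm.orientation,
        Real.sign_of_neg hneg]
      norm_num

theorem exists_linearMap_sub {p : Fin 5 → R4} (hp : AffineIndependent ℝ p) (q : Fin 5 → R4) :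
    ∃ e : R4 →ₗ[ℝ] R4, ∀ b c, e (p b - p c) = q b - q c := by
  obtain ⟨g, hg⟩ := exists_isDual hp
  refine ⟨∑ a, (innerₛₗ ℝ (g a)).smulRight (q a), fun b c => ?_⟩
  simp [hg _ _ _, sub_smul]

/-- The bivectors of a form `s ⋆(e ∧ e)` are those of the image of `p` under `e`. -/
theorem value_of_isDual {p g q : Fin 5 → R4} (hg : IsDual g q) {s : ℝ} (hs : s = 1 ∨ s = -1)
    {e : R4 →ₗ[ℝ] R4} (he : ∀ b c, e (p b - p c) = q b - q c) (hpos : 0 < s * mapDet e)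
    {a b c d f : Fin 5} (hn : [a, b, c, d, f].Nodup) (hor : PositiveOrder p a b c d f) :
    (1 / 2 : ℝ) • s • hodge (wedge (e (p d - p c)) (e (p f - p c))) =
      (vol q / 2) • wedge (g a) (g b) := by
  have h1 : s * det4 (q c - q a) (q c - q b) (q d - q c) (q f - q c) = vol q := by
    have h2 : 0 < s * det4 (q c - q a) (q c - q b) (q d - q c) (q f - q c) := by
      simp only [← he]
      rw [det4_map, ← mapDet, ← mul_assoc]
      exact mul_pos hpos (positiveOrder_iff.1 hor)
    rw [← abs_det4_eq_vol q hn, ← abs_of_pos h2, abs_mul]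
    rcases hs with rfl | rfl <;> simp
  rw [he, he, hg.hodge_wedge_eq hn, smul_smul s, h1, smul_smul]
  congr 1
  ring

theorem hodge_add (X Y : Bivector) : hodge (X + Y) = hodge X + hodge Y := by
  ext I J
  simp [hodge, mul_add, Finset.sum_add_distrib]

theorem hodge_smul (r : ℝ) (X : Bivector) : hodge (r • X) = r • hodge X := by
  ext I J
  simp only [hodge, Matrix.of_apply, Matrix.smul_apply, smul_eq_mul, Finset.mul_sum]
  refine Finset.sum_congr rfl fun K _ => Finset.sum_congr rfl fun L _ => ?_
  ring

theorem hodge_wedge_transpose (u v : R4) :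
    (hodge (wedge u v)).transpose = -hodge (wedge u v) := by
  rw [hodge_wedge]
  ext I J; fin_cases I <;> fin_cases J <;> simp

theorem exists_hodge_wedge_form (s : ℝ) (e : R4 →ₗ[ℝ] R4) :
    ∃ B : TwoForm, ∀ u v : R4, B ![u, v] = s • hodge (wedge (e u) (e v)) := by
  have hadd (u u' v : R4) : wedge (u + u') v = wedge u v + wedge u' v := by
    ext I J; simp [wedge]; ring
  have hadd' (u v v' : R4) : wedge u (v + v') = wedge u v + wedge u v' := by
    ext I J; simp [wedge]; ring
  have hsmul (r : ℝ) (u v : R4) : wedge (r • u) v = r • wedge u v := by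
    ext I J; simp [wedge]; ring
  have hsmul' (r : ℝ) (u v : R4) : wedge u (r • v) = r • wedge u v := by
    ext I J; simp [wedge]; ring
  have hself (u : R4) : wedge u u = (0 : ℝ) • wedge u u := by
    ext I J; simp [wedge]; ring
  refine ⟨twoFormOfBilin (LinearMap.mk₂ ℝ (fun u v => s • hodge (wedge (e u) (e v)))
    (fun u u' v => ?_) (fun r u v => ?_) (fun u v v' => ?_) (fun r u v => ?_)) (fun u => ?_),
    fun u v => rfl⟩
  · rw [map_add, hadd, hodge_add, smul_add]
  · rw [map_smul, hsmul, hodge_smul, smul_comm]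
  · rw [map_add, hadd', hodge_add, smul_add]
  · rw [map_smul, hsmul', hodge_smul, smul_comm]
  · rw [LinearMap.mk₂_apply, hself, hodge_smul, zero_smul, smul_zero]

/-- For arbitrary bivectors: `ν ω = 1` says that the two-form is `s ⋆(e ∧ e)` with `s` the sign of
`det e`, and the simplex is then the image of the chart simplex under `e`. -/
theorem inEinsteinHilbertSector_iff {p : Fin 5 → R4} (hp : AffineIndependent ℝ p)
    (𝓑 : Fin 5 → Fin 5 → Bivector) :
    InEinsteinHilbertSector p 𝓑 ↔ HasReconstructionSign 𝓑 1 := by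
  rw [hasReconstructionSign_one_iff]
  constructor
  · rintro ⟨B, hB, hEH⟩
    obtain ⟨s, e, hs, hpos, he⟩ := (sector_mul_orientation_eq_one_iff B).1 hEH
    have hd : mapDet e ≠ 0 := by rintro h0; simp [h0] at hpos
    have hq : AffineIndependent ℝ (e ∘ p) :=
      hp.map' e.toAffineMap (injective_of_mapDet_ne_zero hd)
    obtain ⟨g, hg⟩ := exists_isDual hq
    refine ⟨g, e ∘ p, hg, fun a b hab => ?_⟩
    obtain ⟨c, d, f, hn, hor⟩ := exists_positiveOrder hp hab
    rw [← hB.2 a b c d f hn hor, triangleIntegral_const, he]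
    exact value_of_isDual hg hs (by simp) hpos hn hor
  · rintro ⟨g, q, hg, h⟩
    obtain ⟨e, he⟩ := exists_linearMap_sub hp q
    have hd : mapDet e ≠ 0 := by
      have h0 := left_ne_zero_of_mul_eq_one
        (hg.det4_mul_eq_one (a := 0) (b := 1) (c := 2) (d := 3) (e := 4) (by decide))
      simp only [← he] at h0
      rw [det4_map, ← mapDet] at h0
      exact left_ne_zero_of_mul h0
    obtain ⟨s, hs, hpos⟩ : ∃ s : ℝ, (s = 1 ∨ s = -1) ∧ 0 < s * mapDet e := by
      rcases hd.lt_or_gt with hlt | hgt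
      · exact ⟨-1, Or.inr rfl, by linarith⟩
      · exact ⟨1, Or.inl rfl, by linarith⟩
    obtain ⟨B, hB⟩ := exists_hodge_wedge_form s e
    refine ⟨B, ⟨fun u v => ?_, fun a b c d f hn hor => ?_⟩,
      (sector_mul_orientation_eq_one_iff _).2 ⟨s, e, hs, hpos, hB⟩⟩
    · rw [hB, Matrix.transpose_smul, hodge_wedge_transpose, smul_neg]
    · rw [triangleIntegral_const, hB, h a b (by rintro rfl; simp at hn)]
      exact value_of_isDual hg hs he hpos hn hor

/-! ### The normals of the tetrahedra -/

/-- The vector `(0, n)` of `ℝ⁴`. -/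
noncomputable def spatial (n : R3) : R4 := WithLp.toLp 2 (Fin.cons 0 ⇑n)

theorem spatial_zero_apply (n : R3) : spatial n 0 = 0 := rfl

theorem spatial_one_apply (n : R3) : spatial n 1 = n 0 := rfl

theorem spatial_two_apply (n : R3) : spatial n 2 = n 1 := rfl

theorem spatial_three_apply (n : R3) : spatial n 3 = n 2 := rfl

theorem act_zero_apply (G : Spin4) (V : R4) :
    act G V 0 = (Matrix.trace (G.1.1 * zeta V * (G.2⁻¹).1)).re / 2 := rfl

theorem act_one_apply (G : Spin4) (V : R4) :
    act G V 1 = (Matrix.trace (tau 0 * (G.1.1 * zeta V * (G.2⁻¹).1))).re := rfl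

theorem act_two_apply (G : Spin4) (V : R4) :
    act G V 2 = (Matrix.trace (tau 1 * (G.1.1 * zeta V * (G.2⁻¹).1))).re := rfl

theorem act_three_apply (G : Spin4) (V : R4) :
    act G V 3 = (Matrix.trace (tau 2 * (G.1.1 * zeta V * (G.2⁻¹).1))).re := rfl

theorem zeta_spatial (n : R3) : zeta (spatial n) = (-2 : ℂ) • su2 n := by
  simp only [zeta, spatial, su2, tau]
  ext i j
  fin_cases i <;> fin_cases j <;> simp [Fin.sum_univ_three, pauli] <;> ring

theorem zeta_refNormal : zeta refNormal = 1 := by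
  ext i j; fin_cases i <;> fin_cases j <;> simp [zeta_form, refNormal]

theorem zeta_injective : Function.Injective zeta := by
  intro u v h
  rw [zeta_form, zeta_form] at h
  have h00 := congrFun (congrFun h 0) 0
  have h01 := congrFun (congrFun h 0) 1
  simp [Complex.ext_iff] at h00 h01
  ext i
  fin_cases i <;> simp [h00, h01]

theorem zeta_add (u v : R4) : zeta (u + v) = zeta u + zeta v := by
  simp only [zeta_form]
  ext i j
  fin_cases i <;> fin_cases j <;> simp <;> ring

theorem zeta_smul (r : ℝ) (u : R4) : zeta (r • u) = (r : ℂ) • zeta u := by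
  simp only [zeta_form]
  ext i j
  fin_cases i <;> fin_cases j <;> simp <;> ring

/-- The action of an element of `Spin(4)` on `ℝ⁴` as a linear map. -/
noncomputable def actLin (G : Spin4) : R4 →ₗ[ℝ] R4 where
  toFun := act G
  map_add' u v := zeta_injective (by
    simp only [zeta_act, zeta_add, mul_add, add_mul])
  map_smul' r u := zeta_injective (by
    simp only [zeta_act, zeta_smul, RingHom.id_apply, mul_smul_comm, smul_mul_assoc])

theorem actLin_apply (G : Spin4) (u : R4) : actLin G u = act G u := rfl

theorem act_mul (G H : Spin4) (u : R4) : act (G * H) u = act G (act H u) := by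
  apply zeta_injective
  simp [zeta_act, mul_assoc]

theorem act_one (u : R4) : act 1 u = u := by
  apply zeta_injective
  simp [zeta_act]

theorem star_mul_self (X : SU2) : (X⁻¹).1 * X.1 = 1 := by
  have : X⁻¹ * X = 1 := inv_mul_cancel X
  exact congrArg Subtype.val this

theorem star_inv (X : SU2) : star (X⁻¹).1 = X.1 := by
  rw [inv_form, star_star]

theorem zeta_act_mul_star (G : Spin4) (u v : R4) :
    zeta (act G v) * star (zeta (act G u)) = G.1.1 * (zeta v * star (zeta u)) * (G.1⁻¹).1 := by
  rw [zeta_act, zeta_act, star_mul, star_mul, star_inv, ← inv_form]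
  calc _ = G.1.1 * zeta v * ((G.2⁻¹).1 * G.2.1) * (star (zeta u) * (G.1⁻¹).1) := by
        simp only [mul_assoc]
    _ = _ := by rw [star_mul_self]; simp only [mul_assoc, mul_one]

theorem star_zeta_act_mul (G : Spin4) (u v : R4) :
    star (zeta (act G u)) * zeta (act G v) = G.2.1 * (star (zeta u) * zeta v) * (G.2⁻¹).1 := by
  rw [zeta_act, zeta_act, star_mul, star_mul, star_inv, ← inv_form]
  calc _ = G.2.1 * star (zeta u) * ((G.1⁻¹).1 * G.1.1) * (zeta v * (G.2⁻¹).1) := by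
        simp only [mul_assoc]
    _ = _ := by rw [star_mul_self]; simp only [mul_assoc, mul_one]

theorem trace_zeta_mul_star (u v : R4) :
    (Matrix.trace (zeta v * star (zeta u))).re = 2 * inner ℝ u v := by
  rw [zeta_form, zeta_form, star_form, inner_eq]
  simp [Matrix.trace_fin_two]
  ring

theorem inner_act (G : Spin4) (u v : R4) : inner ℝ (act G u) (act G v) = inner ℝ u v := by
  have h := trace_zeta_mul_star (act G u) (act G v)
  rw [zeta_act_mul_star, Matrix.trace_mul_comm, ← mul_assoc, star_mul_self, one_mul,
    trace_zeta_mul_star] at h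
  linarith

/-- `Spin(4)` acts with determinant `1`. By multiplicativity it suffices to treat the two factors
`SU(2)`, where the determinant is the square of the squared norm of a unit quaternion. -/
theorem det4_act (G : Spin4) (u v w x : R4) :
    det4 (act G u) (act G v) (act G w) (act G x) = det4 u v w x := by
  have hnorm (X : SU2) (α β : ℂ)
      (hX : X.1 = !![α, -(starRingEnd ℂ) β; β, (starRingEnd ℂ) α]) :
      α.re ^ 2 + α.im ^ 2 + β.re ^ 2 + β.im ^ 2 = 1 := by
    have h := (Matrix.mem_specialUnitaryGroup_iff.1 X.2).2
    rw [hX, Matrix.det_fin_two] at h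
    have := congrArg Complex.re h
    simp at this
    linarith
  have hl (X : SU2) : mapDet (actLin (X, 1)) = 1 := by
    obtain ⟨α, β, hX⟩ := quat_form X
    have h1 := hnorm X α β hX
    have h2 : mapDet (actLin (X, 1)) = (α.re ^ 2 + α.im ^ 2 + β.re ^ 2 + β.im ^ 2) ^ 2 := by
      simp only [mapDet, actLin_apply, det4_eq, act_zero_apply, act_one_apply, act_two_apply,
        act_three_apply, hX, zeta_form]
      simp [tau, pauli, Matrix.trace_fin_two]
      ring
    rw [h2, h1, one_pow]
  have hr (X : SU2) : mapDet (actLin (1, X)) = 1 := by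
    obtain ⟨α, β, hX⟩ := quat_form X
    have h1 := hnorm X α β hX
    have h2 : mapDet (actLin (1, X)) = (α.re ^ 2 + α.im ^ 2 + β.re ^ 2 + β.im ^ 2) ^ 2 := by
      simp only [mapDet, actLin_apply, det4_eq, act_zero_apply, act_one_apply, act_two_apply,
        act_three_apply, inv_form, hX, star_form, zeta_form]
      simp [tau, pauli, Matrix.trace_fin_two]
      ring
    rw [h2, h1, one_pow]
  have hG (y : R4) : act G y = actLin (G.1, 1) (actLin (1, G.2) y) := by
    rw [actLin_apply, actLin_apply, ← act_mul]; simp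
  simp only [hG]
  rw [det4_map, ← mapDet, hl, det4_map, ← mapDet, hr, one_mul, one_mul]

/-- `X⁻ ▷ n` is the imaginary part of the quaternion `ζ(v) ζ(u)†`, for `u = G·𝒩` and
`v = G·(0, n)`: the anti-self-dual part of `u ∧ v`. -/
theorem adj_fst (G : Spin4) (n : R3) (i : Fin 3) :
    adj G.1 n i = (Matrix.trace (tau i *
      (zeta (act G (spatial n)) * star (zeta (act G refNormal))))).re := by
  rw [zeta_act_mul_star, zeta_spatial, zeta_refNormal, star_one, mul_one, adj]
  simp

/-- `X⁺ ▷ n` is the imaginary part of the quaternion `ζ(u)† ζ(v)`, for `u = G·𝒩` and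
`v = G·(0, n)`: the self-dual part of `u ∧ v`. -/
theorem adj_snd (G : Spin4) (n : R3) (i : Fin 3) :
    adj G.2 n i = (Matrix.trace (tau i *
      (star (zeta (act G refNormal)) * zeta (act G (spatial n))))).re := by
  rw [star_zeta_act_mul, zeta_spatial, zeta_refNormal, star_one, one_mul, adj]
  simp

/-- Equivariance of `(J₋, J₊) ↦ J^{IJ}`, on the bivector `(-n, n)`, which stands for `2 𝒩 ∧ n`. -/
theorem toBivector_adj (G : Spin4) (n : R3) :
    toBivector (-adj G.1 n) (adj G.2 n) =
      (2 : ℝ) • wedge (act G refNormal) (act G (spatial n)) := by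
  have h1 := adj_fst G n
  have h2 := adj_snd G n
  generalize act G refNormal = u at *
  generalize act G (spatial n) = v at *
  have e1 (i) : adj G.1 n i = u 0 * v i.succ - v 0 * u i.succ -
      ![u 2 * v 3 - u 3 * v 2, u 3 * v 1 - u 1 * v 3, u 1 * v 2 - u 2 * v 1] i := by
    rw [h1, zeta_form, zeta_form, star_form]
    fin_cases i <;>
      simp [tau, pauli, Matrix.trace_fin_two] <;> ring
  have e2 (i) : adj G.2 n i = u 0 * v i.succ - v 0 * u i.succ +
      ![u 2 * v 3 - u 3 * v 2, u 3 * v 1 - u 1 * v 3, u 1 * v 2 - u 2 * v 1] i := by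
    rw [h2, zeta_form, zeta_form, star_form]
    fin_cases i <;>
      simp [tau, pauli, Matrix.trace_fin_two] <;> ring
  ext I J
  fin_cases I <;> fin_cases J <;>
    simp [toBivector, wedge, e1, e2] <;> ring

/-- The physical bivectors are simple, with the factor `G_a·𝒩`. -/
theorem physBivector_eq (D : ReducedBoundaryData) (G : Fin 5 → Spin4) (a b : Fin 5) :
    D.physBivector G a b = D.area a b •
      wedge (act (G a) refNormal) (act (G a) (spatial (D.normal a b))) := by
  rw [ReducedBoundaryData.physBivector, toBivector_adj, smul_smul]
  congr 1; ring

theorem physBivector_swap {D : ReducedBoundaryData} {G : Fin 5 → Spin4} (hor : D.Orientation G)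
    {a b : Fin 5} (hab : a ≠ b) : D.physBivector G b a = -D.physBivector G a b := by
  obtain ⟨h1, h2⟩ := hor a b hab
  rw [ReducedBoundaryData.physBivector, ReducedBoundaryData.physBivector, h1, h2,
    D.area_symm a b hab, ← smul_neg]
  congr 1
  ext I J
  fin_cases I <;> fin_cases J <;> simp [toBivector] <;> ring

theorem spatial_sum {ι : Type*} (s : Finset ι) (r : ι → ℝ) (n : ι → R3) :
    spatial (∑ i ∈ s, r i • n i) = ∑ i ∈ s, r i • spatial (n i) := by
  ext J
  refine Fin.cases ?_ (fun j => ?_) J <;> simp [spatial]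

theorem spatial_zero : spatial 0 = 0 := by
  ext J
  refine Fin.cases ?_ (fun j => ?_) J <;> simp [spatial]

theorem sum_area_smul_act {D : ReducedBoundaryData} (hcl : D.Closure) (G : Fin 5 → Spin4)
    (a : Fin 5) : ∑ b ∈ Finset.univ.erase a,
      D.area a b • act (G a) (spatial (D.normal a b)) = 0 := by
  simp only [← actLin_apply, ← map_smul, ← map_sum]
  rw [← spatial_sum, hcl a, spatial_zero, map_zero]

theorem act_rel (G : Fin 5 → Spin4) (a b : Fin 5) (u : R4) :
    act (rel G a b) u = act (G a)⁻¹ (act (G b) u) := by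
  rw [rel, act_mul]

/-- Applying `G_a` to the four vectors `𝒩, G_{ac}·𝒩, G_{ad}·𝒩, G_{ae}·𝒩` turns the triple product
into a determinant of tetrahedron normals. -/
theorem spatialTriple_eq (G : Fin 5 → Spin4) (a c d e : Fin 5) :
    spatialTriple G a c d e = det4 (act (G a) refNormal) (act (G c) refNormal)
      (act (G d) refNormal) (act (G e) refNormal) := by
  rw [← det4_act (G a)⁻¹, ← act_mul (G a)⁻¹ (G a), inv_mul_cancel, act_one]
  simp only [spatialTriple, act_rel]
  rw [det4_eq, Matrix.det_fin_three]
  simp [refNormal, show (Fin.succ 2 : Fin 4) = 3 from rfl]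
  ring

theorem sum_trace_mul_rotGen (κ γ : ℝ) (D : ReducedBoundaryData) (G : Fin 5 → Spin4)
    (a b : Fin 5) : ∑ i : Fin 3, (Matrix.trace (tau i * ((rel G a b).1.1 * (rel G b a).2.1))).re *
      D.rotGen κ γ a b i = D.area a b / (κ * γ) *
        inner ℝ (act (G a) (spatial (D.normal a b))) (act (G b) refNormal) := by
  rw [← inner_act (G a)⁻¹, ← act_mul (G a)⁻¹ (G a), inv_mul_cancel, act_one, ← act_rel, inner_eq]
  simp only [← act_rel_refNormal, Complex.ofReal_re, ReducedBoundaryData.rotGen]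
  simp [Fin.sum_univ_three, spatial_zero_apply, spatial_one_apply, spatial_two_apply,
    spatial_three_apply,
    show (Fin.succ 2 : Fin 4) = 3 from rfl]
  ring

theorem inner_refNormal_spatial (n : R3) : inner ℝ refNormal (spatial n) = 0 := by
  simp [inner_eq, refNormal, spatial]

theorem inner_refNormal_self : inner ℝ refNormal refNormal = 1 := by
  simp [refNormal]

theorem inner_spatial_self (n : R3) : inner ℝ (spatial n) (spatial n) = ‖n‖ ^ 2 := by
  rw [inner_eq, EuclideanSpace.norm_sq_eq]
  simp [spatial_zero_apply, spatial_one_apply, spatial_two_apply, spatial_three_apply,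
    Fin.sum_univ_three]
  ring

/-! ### Reconstruction of the simplex from its normals -/

/-- Unit vectors `N a` and, for `b ≠ a`, unit vectors `v a b` orthogonal to `N a`, such that the
bivectors `area a b • N a ∧ v a b` are antisymmetric in `a, b` and satisfy closure. -/
structure NormalConfiguration where
  area : Fin 5 → Fin 5 → ℝ
  N : Fin 5 → R4
  v : Fin 5 → Fin 5 → R4
  area_symm : ∀ a b, a ≠ b → area a b = area b a
  area_pos : ∀ a b, a ≠ b → 0 < area a b
  inner_N_N : ∀ a, inner ℝ (N a) (N a) = 1
  inner_N_v : ∀ a b, a ≠ b → inner ℝ (N a) (v a b) = 0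
  inner_v_v : ∀ a b, a ≠ b → inner ℝ (v a b) (v a b) = 1
  swap : ∀ a b, a ≠ b →
    area b a • wedge (N b) (v b a) = -(area a b • wedge (N a) (v a b))
  closure : ∀ a, ∑ b ∈ Finset.univ.erase a, area a b • v a b = 0

namespace NormalConfiguration

variable (C : NormalConfiguration)

/-- The component of `N b` along `v a b`; up to sign, the sine of the angle between `N a` and
`N b`. -/
noncomputable def sine (a b : Fin 5) : ℝ := inner ℝ (C.v a b) (C.N b)

variable {C}

/-- Contract the antisymmetry of the bivectors with `N b`. -/
theorem v_swap {a b : Fin 5} (hab : a ≠ b) :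
    C.v b a = C.sine a b • C.N a - (inner ℝ (C.N a) (C.N b) : ℝ) • C.v a b := by
  have h := congrArg (fun X : Bivector => WithLp.toLp 2 (X.mulVec ⇑(C.N b))) (C.swap a b hab)
  simp only [Matrix.neg_mulVec, Matrix.smul_mulVec, WithLp.toLp_neg, WithLp.toLp_smul,
    wedge_mulVec, C.inner_N_N, real_inner_comm (C.N b) (C.v b a),
    C.inner_N_v b a hab.symm, ← C.area_symm a b hab] at h
  rw [← smul_neg] at h
  have h2 := smul_right_injective R4 (C.area_pos a b hab).ne' h
  simp only [zero_smul, one_smul, zero_sub, neg_inj] at h2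
  exact h2

theorem inner_sq_add_sine_sq {a b : Fin 5} (hab : a ≠ b) :
    (inner ℝ (C.N a) (C.N b)) ^ 2 + C.sine a b ^ 2 = 1 := by
  have h := C.inner_v_v b a hab.symm
  rw [v_swap hab] at h
  simp only [inner_sub_left, inner_sub_right, real_inner_smul_left, real_inner_smul_right,
    C.inner_N_N, C.inner_N_v a b hab, real_inner_comm (C.N a) (C.v a b), C.inner_v_v a b hab] at h
  linarith

theorem N_eq {a b : Fin 5} (hab : a ≠ b) :
    C.N b = (inner ℝ (C.N a) (C.N b) : ℝ) • C.N a + C.sine a b • C.v a b := by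
  rw [← sub_eq_zero, ← inner_self_eq_zero (𝕜 := ℝ)]
  have h1 := inner_sq_add_sine_sq (C := C) hab
  have h2 : inner ℝ (C.N b) (C.v a b) = C.sine a b := real_inner_comm _ _
  have h3 : inner ℝ (C.v a b) (C.N b) = C.sine a b := rfl
  simp only [inner_sub_left, inner_sub_right, inner_add_left, inner_add_right,
    real_inner_smul_left, real_inner_smul_right, C.inner_N_N, C.inner_N_v a b hab,
    real_inner_comm (C.N a) (C.v a b), C.inner_v_v a b hab, real_inner_comm (C.N a) (C.N b),
    h2, h3]
  linarith

theorem sine_swap {a b : Fin 5} (hab : a ≠ b) : C.sine b a = C.sine a b := by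
  rw [sine, v_swap hab]
  simp only [inner_sub_left, real_inner_smul_left, C.inner_N_N,
    real_inner_comm (C.N a) (C.v a b), C.inner_N_v a b hab]
  ring

theorem wedge_v {a b : Fin 5} (hab : a ≠ b) (h : C.sine a b ≠ 0) :
    wedge (C.N a) (C.v a b) = (C.sine a b)⁻¹ • wedge (C.N a) (C.N b) := by
  have h1 : wedge (C.N a) (C.N b) = C.sine a b • wedge (C.N a) (C.v a b) := by
    conv_lhs => rw [N_eq hab]
    ext I J
    simp [wedge]
    ring
  rw [h1, inv_smul_smul₀ h]

end NormalConfiguration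

theorem eq_zero_of_sum_smul_eq_zero {N : Fin 5 → R4} {a b c d e : Fin 5}
    (h : [a, b, c, d, e].Nodup) (hdet : det4 (N b) (N c) (N d) (N e) ≠ 0) {w : Fin 5 → ℝ}
    (hw : ∑ i, w i • N i = 0) (ha : w a = 0) : w = 0 := by
  rw [sum_eq_of_nodup h, ha, zero_smul, zero_add] at hw
  obtain ⟨hb, hc, hd, he⟩ := eq_zero_of_relation hdet hw
  have h0 : ∑ i, w i ^ 2 = 0 := by rw [sum_eq_of_nodup h, ha, hb, hc, hd, he]; norm_num
  ext i
  simpa using (Finset.sum_eq_zero_iff_of_nonneg fun _ _ => sq_nonneg _).1 h0 i (Finset.mem_univ i)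

theorem mul_neg_of_neg_sign_mul_pos {P t : ℝ} (h : 0 < -Real.sign P * t) : P * t < 0 := by
  rcases lt_trichotomy P 0 with hP | rfl | hP
  · rw [Real.sign_of_neg hP] at h
    exact mul_neg_of_neg_of_pos hP (by linarith)
  · simp at h
  · rw [Real.sign_of_pos hP] at h
    exact mul_neg_of_pos_of_neg hP (by linarith)

theorem neg_sign_mul_pos_of_mul_neg {P t : ℝ} (h : P * t < 0) : 0 < -Real.sign P * t := by
  rcases lt_trichotomy P 0 with hP | rfl | hP
  · rw [Real.sign_of_neg hP]
    have := pos_of_mul_neg_right h hP.le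
    linarith
  · simp at h
  · rw [Real.sign_of_pos hP]
    have := neg_of_mul_neg_right h hP.le
    linarith

/-- Under scaling of a simplex by `τ`, the bivectors `(vol q / 2) g_a ∧ g_b` scale by `τ²`. -/
theorem IsDual.exists_rescale {M q : Fin 5 → R4} (hM : IsDual M q) {k : ℝ} (hk : 0 < k) :
    ∃ M' q', IsDual M' q' ∧
      ∀ a b, k • wedge (M a) (M b) = (vol q' / 2) • wedge (M' a) (M' b) := by
  have hV := hM.vol_pos
  set τ : ℝ := Real.sqrt (2 * k / vol q) with hτ
  have hτ0 : 0 < τ := Real.sqrt_pos.2 (by positivity)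
  have hτ2 : τ ^ 2 = 2 * k / vol q := Real.sq_sqrt (by positivity)
  refine ⟨_, _, hM.smul hτ0.ne', fun a b => ?_⟩
  have hvol : vol (fun a => τ • q a) = τ ^ 4 * vol q := by
    have hn : [(0 : Fin 5), 1, 2, 3, 4].Nodup := by decide
    rw [← abs_det4_eq_vol _ hn, ← abs_det4_eq_vol _ hn]
    simp only [← smul_sub]
    rw [det4_smul, abs_mul, abs_of_pos (by positivity)]
    ring
  rw [wedge_smul_smul, smul_smul, hvol]
  congr 1
  have : k = τ ^ 2 * vol q / 2 := by rw [hτ2]; field_simp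
  rw [this]
  field_simp

namespace NormalConfiguration

variable {C : NormalConfiguration}

/-- The sign condition for one pair yields independence of enough normals. The closure relations
then are five linear relations between `N 0, …, N 4`, with symmetric off-diagonal coefficients
`area / sine`; the relations being proportional, the coefficient matrix has rank one, which
exhibits the bivectors as wedge products of multiples of the `N a` adding up to zero. -/
theorem exists_isDual_of_pos {a b c d e : Fin 5} (hn : [a, b, c, d, e].Nodup)
    (hpos : 0 < -Real.sign (det4 (C.N a) (C.N c) (C.N d) (C.N e) *
      det4 (C.N b) (C.N c) (C.N d) (C.N e)) * C.sine a b) :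
    ∃ g q, IsDual g q ∧ ∀ x y, x ≠ y →
      C.area x y • wedge (C.N x) (C.v x y) = (vol q / 2) • wedge (g x) (g y) := by
  have hP := mul_neg_of_neg_sign_mul_pos hpos
  have ht : C.sine a b ≠ 0 := right_ne_zero_of_mul hP.ne
  have hda := left_ne_zero_of_mul (left_ne_zero_of_mul hP.ne)
  have hdb := right_ne_zero_of_mul (left_ne_zero_of_mul hP.ne)
  have hn' : [b, a, c, d, e].Nodup := (List.Perm.nodup_iff (List.Perm.swap b a [c, d, e])).1 hn
  have hab : a ≠ b := by rintro rfl; simp at hn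
  -- no two of the normals are parallel
  have hsine (x y : Fin 5) (hxy : x ≠ y) : C.sine x y ≠ 0 := by
    intro h0
    have hNy := C.N_eq hxy
    rw [h0, zero_smul, add_zero] at hNy
    -- the support `{x, y}` of this relation misses `a` or `b`, against independence, or is `{a, b}`
    set w : Fin 5 → ℝ := Pi.single y 1 - (inner ℝ (C.N x) (C.N y) : ℝ) • Pi.single x 1 with hw
    have hsum : ∑ i, w i • C.N i = 0 := by
      simp only [hw, Pi.sub_apply, Pi.smul_apply, Pi.single_apply, sub_smul, smul_eq_mul,
        Finset.sum_sub_distrib, mul_ite, mul_one, mul_zero, ite_smul, one_smul, zero_smul,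
        Finset.sum_ite_eq', Finset.mem_univ, if_true]
      rw [sub_eq_zero, ← hNy]
    have hwy : w y = 1 := by simp [hw, hxy.symm]
    have hwz (z) (h1 : z ≠ x) (h2 : z ≠ y) : w z = 0 := by simp [hw, h1, h2]
    have hwa : w a ≠ 0 := fun h => by
      rw [eq_zero_of_sum_smul_eq_zero hn hdb hsum h] at hwy; simp at hwy
    have hwb : w b ≠ 0 := fun h => by
      rw [eq_zero_of_sum_smul_eq_zero hn' hda hsum h] at hwy; simp at hwy
    by_cases hax : a = x
    · by_cases hby : b = y
      · rw [← hax, ← hby] at h0; exact ht h0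
      · exact hwb (hwz b (fun h => hab (hax.trans h.symm)) hby)
    · by_cases hay : a = y
      · by_cases hbx : b = x
        · rw [← hay, ← hbx, sine_swap hab] at h0; exact ht h0
        · exact hwb (hwz b hbx (fun h => hab (hay.trans h.symm)))
      · exact hwa (hwz a hax hay)
  -- the diagonal entries make each row of `K` a linear relation between the `N x`, by closure
  let K : Fin 5 → Fin 5 → ℝ := fun r x => if x = r then
    -∑ y ∈ Finset.univ.erase r, C.area r y * (C.sine r y)⁻¹ * inner ℝ (C.N r) (C.N y)
    else C.area r x * (C.sine r x)⁻¹
  have hK {r x} (h : r ≠ x) : K r x = C.area r x * (C.sine r x)⁻¹ := if_neg h.symm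
  have hKne {r x} (h : r ≠ x) : K r x ≠ 0 := by
    rw [hK h]; exact mul_ne_zero (C.area_pos r x h).ne' (inv_ne_zero (hsine r x h))
  have hKsymm (r x) : K r x = K x r := by
    by_cases h : r = x
    · rw [h]
    · rw [hK h, hK (Ne.symm h), C.area_symm r x h, sine_swap h]
  have hrel (r) : ∑ x, K r x • C.N x = 0 := by
    rw [← Finset.add_sum_erase _ _ (Finset.mem_univ r)]
    have h1 : ∑ x ∈ Finset.univ.erase r, K r x • C.N x =
        ∑ x ∈ Finset.univ.erase r, ((C.area r x * (C.sine r x)⁻¹ *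
          inner ℝ (C.N r) (C.N x)) • C.N r + C.area r x • C.v r x) := by
      refine Finset.sum_congr rfl fun x hx => ?_
      have hx' : r ≠ x := (Finset.ne_of_mem_erase hx).symm
      conv_lhs => rw [hK hx', N_eq hx', smul_add, smul_smul, smul_smul,
        inv_mul_cancel_right₀ (hsine r x hx')]
    rw [h1, Finset.sum_add_distrib, C.closure, ← Finset.sum_smul, add_zero, ← add_smul]
    simp [K]
  -- the combination of rows `r` and `a` without `N a` vanishes, `N b, …, N e` being independent
  have hrank (r s) : K r a * K a s = K a a * K r s := by
    have := eq_zero_of_sum_smul_eq_zero hn hdb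
      (w := fun x => K r a * K a x - K a a * K r x) (by
        simp only [sub_smul, mul_smul, Finset.sum_sub_distrib, ← Finset.smul_sum, hrel]
        simp) (by ring)
    exact sub_eq_zero.1 (congrFun this s)
  have hac : a ≠ c := by rintro rfl; simp at hn
  have had : a ≠ d := by rintro rfl; simp at hn
  have hae : a ≠ e := by rintro rfl; simp at hn
  have hcd : c ≠ d := by rintro rfl; simp at hn
  have hKaa : 0 < K a a := by
    have h0 : K a a ≠ 0 := fun h => by
      have := hrank c d
      rw [h, zero_mul] at this
      exact mul_ne_zero (hKne hac.symm) (hKne had) this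
    have h1 := hrel a
    rw [sum_eq_of_nodup hn] at h1
    have h2 := det4_relation h1
    set da := det4 (C.N a) (C.N c) (C.N d) (C.N e)
    set db := det4 (C.N b) (C.N c) (C.N d) (C.N e)
    have h3 : K a b * C.sine a b = C.area a b := by
      rw [hK hab, mul_assoc, inv_mul_cancel₀ ht, mul_one]
    have h4 : (da * db * C.sine a b) * K a a = -(C.area a b * db ^ 2) := by
      rw [← h3]
      linear_combination db * C.sine a b * h2
    have h5 : 0 < C.area a b * db ^ 2 := mul_pos (C.area_pos a b hab) (by positivity)
    by_contra hle
    have := mul_nonneg_of_nonpos_of_nonpos hP.le (not_lt.1 hle)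
    linarith
  have hMdet : det4 (K a b • C.N b) (K a c • C.N c) (K a d • C.N d) (K a e • C.N e) ≠ 0 := by
    rw [det4_smul]
    exact mul_ne_zero (mul_ne_zero (mul_ne_zero (mul_ne_zero (hKne hab) (hKne hac)) (hKne had))
      (hKne hae)) hdb
  obtain ⟨q, hq⟩ := exists_isDual_of_sum_eq_zero (M := fun x => K a x • C.N x) (hrel a) hn hMdet
  obtain ⟨g, q', hg, h⟩ := hq.exists_rescale (inv_pos.2 hKaa)
  refine ⟨g, q', hg, fun x y hxy => ?_⟩
  rw [← h, wedge_smul_smul, hKsymm a x, hrank, wedge_v hxy (hsine x y hxy), smul_smul, smul_smul,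
    inv_mul_cancel_left₀ hKaa.ne', hK hxy]

/-- Conversely, the normals of the tetrahedra of a geometrical simplex are proportional to the
gradients of its barycentric coordinates, and the sign condition holds for all pairs. -/
theorem pos_of_isDual {g q : Fin 5 → R4} (hg : IsDual g q)
    (h : ∀ x y, x ≠ y →
      C.area x y • wedge (C.N x) (C.v x y) = (vol q / 2) • wedge (g x) (g y))
    {a b c d e : Fin 5} (hn : [a, b, c, d, e].Nodup) :
    0 < -Real.sign (det4 (C.N a) (C.N c) (C.N d) (C.N e) *
      det4 (C.N b) (C.N c) (C.N d) (C.N e)) * C.sine a b := by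
  have hV := hg.vol_pos
  have happ {x y : Fin 5} (hxy : x ≠ y) (z : R4) :
      C.area x y • ((inner ℝ (C.v x y) z : ℝ) • C.N x - (inner ℝ (C.N x) z : ℝ) • C.v x y) =
      (vol q / 2) • ((inner ℝ (g y) z : ℝ) • g x - (inner ℝ (g x) z : ℝ) • g y) := by
    have := congrArg (fun X : Bivector => WithLp.toLp 2 (X.mulVec ⇑z)) (h x y hxy)
    simpa only [Matrix.smul_mulVec, WithLp.toLp_smul, wedge_mulVec] using this
  -- `N x` is a factor of `g x ∧ g y` for all `y`, hence orthogonal to the facet `x`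
  have hpar (x : Fin 5) : ∃ t : ℝ, t ≠ 0 ∧ C.N x = t • g x := by
    have horth (c d : Fin 5) (hc : c ≠ x) (hd : d ≠ x) : inner ℝ (C.N x) (q c - q d) = 0 := by
      obtain ⟨y, hyx, hyc, hyd⟩ : ∃ y, y ≠ x ∧ y ≠ c ∧ y ≠ d := by
        clear * -; revert x c d; decide
      have h1 := happ hyx.symm (q c - q d)
      rw [hg, hg] at h1
      simp only [hyc.symm, hyd.symm, hc, hd, if_false, sub_self, zero_smul, smul_zero] at h1
      have h2 := (smul_eq_zero.1 h1).resolve_left (C.area_pos x y hyx.symm).ne'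
      have h3 := congrArg (fun z => inner ℝ (C.v x y) z) h2
      simp only [inner_sub_right, real_inner_smul_right, real_inner_comm (C.N x) (C.v x y),
        C.inner_N_v x y hyx.symm, C.inner_v_v x y hyx.symm, inner_zero_right] at h3
      rw [inner_sub_right]
      linarith
    obtain ⟨c, hc, -⟩ := exists_ne_ne x x
    have h1 := hg.eq_smul_of_orthogonal horth hc
    refine ⟨_, fun h0 => ?_, h1⟩
    rw [h0, zero_smul] at h1
    have := C.inner_N_N x
    rw [h1, inner_zero_left] at this
    exact zero_ne_one this
  choose t ht hN using hpar
  have hab : a ≠ b := by rintro rfl; simp at hn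
  have hsine : C.sine a b ≠ 0 := by
    intro h0
    have h1 := C.N_eq hab
    rw [h0, zero_smul, add_zero, hN b, hN a] at h1
    obtain ⟨c, hca, hcb⟩ := exists_ne_ne a b
    have h2 := congrArg (fun z => inner ℝ z (q b - q c)) h1
    simp [real_inner_smul_left, hg _ _ _, hca, hcb, hab.symm, ht] at h2
  have hgN (x) : g x = (t x)⁻¹ • C.N x := by rw [hN x, inv_smul_smul₀ (ht x)]
  -- contract the equality of bivectors with `N a` and `N b`
  have hkey : C.area a b * C.sine a b * (t a * t b) = vol q / 2 * C.sine a b ^ 2 := by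
    have h1 := congrArg (fun z => inner ℝ z (C.N b)) (happ hab (C.N a))
    simp only [hgN, real_inner_smul_left, inner_sub_left, C.inner_N_N,
      real_inner_comm (C.N a) (C.v a b), C.inner_N_v a b hab, real_inner_comm (C.N a) (C.N b)] at h1
    have h2 : inner ℝ (C.v a b) (C.N b) = C.sine a b := rfl
    have h3 := C.inner_sq_add_sine_sq hab
    rw [h2] at h1
    have hta := ht a
    have htb := ht b
    field_simp at h1
    linear_combination (-1 / 2) * h1 + (-vol q / 2) * h3
  have hpos : 0 < C.sine a b * (t a * t b) := by
    have h1 : 0 < C.area a b * (C.sine a b * (t a * t b)) := by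
      rw [← mul_assoc, hkey]; positivity
    exact (mul_pos_iff_of_pos_left (C.area_pos a b hab)).1 h1
  have hrel : ∑ x, (t x)⁻¹ • C.N x = 0 := by simp only [← hgN]; exact hg.sum_eq_zero
  rw [sum_eq_of_nodup hn] at hrel
  have hdet := det4_relation hrel
  have hdb : det4 (C.N b) (C.N c) (C.N d) (C.N e) ≠ 0 := by
    have hn2 : [b, c, a, d, e].Nodup := by
      refine (List.Perm.nodup_iff ?_).1 hn
      exact (List.Perm.swap b a [c, d, e]).trans ((List.Perm.swap c a [d, e]).cons b)
    rw [hN b, hN c, hN d, hN e, det4_smul]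
    exact mul_ne_zero (mul_ne_zero (mul_ne_zero (mul_ne_zero (ht b) (ht c)) (ht d)) (ht e))
      (right_ne_zero_of_mul_eq_one (hg.det4_mul_eq_one hn2))
  apply neg_sign_mul_pos_of_mul_neg
  set da := det4 (C.N a) (C.N c) (C.N d) (C.N e)
  set db := det4 (C.N b) (C.N c) (C.N d) (C.N e)
  have h1 : da * db * C.sine a b * (t b) ^ 2 = -(db ^ 2 * (C.sine a b * (t a * t b))) := by
    have hta := ht a
    have htb := ht b
    field_simp at hdet
    linear_combination db * C.sine a b * t b * hdet
  have h2 : 0 < db ^ 2 * (C.sine a b * (t a * t b)) := mul_pos (by positivity) hpos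
  by_contra hle
  have := mul_nonneg (not_lt.1 hle) (sq_nonneg (t b))
  linarith

end NormalConfiguration

/-! ### The sign condition -/

/-- The vectors `G_a·𝒩` and `G_a·(0, n_{ab})`. -/
noncomputable def normalConfiguration {D : ReducedBoundaryData} (hcl : D.Closure)
    {G : Fin 5 → Spin4} (hor : D.Orientation G) : NormalConfiguration where
  area := D.area
  N a := act (G a) refNormal
  v a b := act (G a) (spatial (D.normal a b))
  area_symm := D.area_symm
  area_pos := D.area_pos
  inner_N_N a := by rw [inner_act, inner_refNormal_self]
  inner_N_v a b _ := by rw [inner_act, inner_refNormal_spatial]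
  inner_v_v a b hab := by rw [inner_act, inner_spatial_self, D.normal_unit a b hab, one_pow]
  swap a b hab := by rw [← physBivector_eq, ← physBivector_eq, physBivector_swap hor hab]
  closure := sum_area_smul_act hcl G

theorem hasReconstructionSign_iff_pos {κ γ : ℝ} (hκ : 0 < κ) (hγ : 0 < γ)
    {D : ReducedBoundaryData} (hcl : D.Closure) {G : Fin 5 → Spin4} (hor : D.Orientation G)
    {a b : Fin 5} (hab : a ≠ b) :
    HasReconstructionSign (D.physBivector G) 1 ↔
      0 < beta G a b * ∑ i : Fin 3,
        (Matrix.trace (tau i * ((rel G a b).1.1 * (rel G b a).2.1))).re * D.rotGen κ γ a b i := by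
  have hn := others_nodup a b hab
  have hC (x y : Fin 5) : D.physBivector G x y = (normalConfiguration hcl hor).area x y •
      wedge ((normalConfiguration hcl hor).N x) ((normalConfiguration hcl hor).v x y) :=
    physBivector_eq D G x y
  have hpos : 0 < D.area a b / (κ * γ) := div_pos (D.area_pos a b hab) (mul_pos hκ hγ)
  rw [hasReconstructionSign_one_iff, sum_trace_mul_rotGen, beta_eq G a b _ _ _ hn,
    spatialTriple_eq, spatialTriple_eq, mul_left_comm, mul_pos_iff_of_pos_left hpos]
  simp only [hC]
  constructor
  · rintro ⟨g, q, hg, h⟩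
    exact NormalConfiguration.pos_of_isDual hg h hn
  · exact NormalConfiguration.exists_isDual_of_pos (C := normalConfiguration hcl hor) hn

theorem existsUnique_isContinuumForm {D : ReducedBoundaryData} (hcl : D.Closure)
    {G : Fin 5 → Spin4} (hor : D.Orientation G) {p : Fin 5 → R4} (hp : AffineIndependent ℝ p) :
    ∃! B : TwoForm, IsContinuumForm p (D.physBivector G) B := by
  -- the diagonal values of the boundary data are arbitrary, and are replaced by `0`
  let 𝓑 : Fin 5 → Fin 5 → Bivector := fun a b => if a = b then 0 else D.physBivector G a b
  have hoff (a b : Fin 5) (hab : a ≠ b) : 𝓑 a b = D.physBivector G a b := if_neg hab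
  have hdiag (a : Fin 5) : 𝓑 a a = 0 := if_pos rfl
  obtain ⟨B, hB⟩ := exists_isContinuumForm hp (𝓑 := 𝓑)
    (fun a b => by
      by_cases hab : a = b
      · rw [hab, hdiag]; simp
      · rw [hoff a b hab, physBivector_eq, Matrix.transpose_smul, ← smul_neg]
        congr 1
        ext I J
        simp [wedge])
    (fun a b => by
      by_cases hab : a = b
      · rw [hab, hdiag]; simp
      · rw [hoff a b hab, hoff b a (Ne.symm hab), physBivector_swap hor hab])
    (fun a => by
      rw [← Finset.add_sum_erase _ _ (Finset.mem_univ a), hdiag, zero_add]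
      have h1 : ∑ b ∈ Finset.univ.erase a, 𝓑 a b = wedge (act (G a) refNormal)
          (∑ b ∈ Finset.univ.erase a, D.area a b • act (G a) (spatial (D.normal a b))) := by
        have h2 : ∑ b ∈ Finset.univ.erase a, 𝓑 a b = ∑ b ∈ Finset.univ.erase a,
            wedge (act (G a) refNormal) (D.area a b • act (G a) (spatial (D.normal a b))) := by
          refine Finset.sum_congr rfl fun b hb => ?_
          rw [hoff a b (Finset.ne_of_mem_erase hb).symm, physBivector_eq]
          ext I J
          simp [wedge]
          ring
        rw [h2, wedge_sum]
      rw [h1, sum_area_smul_act hcl]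
      ext I J
      simp [wedge])
  have hB' := hB.congr hoff
  exact ⟨B, hB', fun B' h => h.unique hp hB'⟩

end EPRL

open EPRL

theorem mainTheorem2 (κ γ : ℝ) (hκ : 0 < κ) (hγ : 0 < γ)
    (D : ReducedBoundaryData) (hD : D.Nondegenerate) (hcl : D.Closure)
    (G : Fin 5 → Spin4) (hor : D.Orientation G)
    (p : Fin 5 → R4) (hp : AffineIndependent ℝ p) :
    (∃! B : TwoForm, IsContinuumForm p (D.physBivector G) B) ∧
    (InEinsteinHilbertSector p (D.physBivector G) ↔
      HasReconstructionSign (D.physBivector G) 1) ∧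
    ∀ a b : Fin 5, a ≠ b →
      (InEinsteinHilbertSector p (D.physBivector G) ↔
        0 < beta G a b * ∑ i : Fin 3,
          (Matrix.trace (tau i * ((rel G a b).1.1 * (rel G b a).2.1))).re * D.rotGen κ γ a b i) := by
  refine ⟨existsUnique_isContinuumForm hcl hor hp, inEinsteinHilbertSector_iff hp _,
    fun a b hab => ?_⟩
  rw [inEinsteinHilbertSector_iff hp]
  exact hasReconstructionSign_iff_pos hκ hγ hcl hor hab
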